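/- **Conventions.** Let $R\subseteq\{0,1\}^*\times\{0,1\}^*$ be a binary relation. $R$ is *polynomially decidable* if a deterministic polynomial-time Turing machine decides $\{(x,y) : (x,y)\in R\}$, and *polynomially balanced* if there is a polynomial $q$ such that $(x,y)\in R$ implies $|y|\le q(|x|)$. $R$ is in $\mathrm{TFUP}$ if it is polynomially decidable, polynomially balanced, and for every $x\in\{0,1\}^*$ there is exactly one $y$ with $(x,y)\in R$. A *deterministic NCCirc algorithm* $\mathcal A$ is a deterministic polynomial-time algorithm that on input $x\in\{0,1\}^*$ outputs a Boolean circuit $\mathcal C_x$ over AND, OR and NOT with the same number $n_x$ of input and output wires, such that for every $x$ the induced function $c_x:\{0,1\}^{n_x}\to\{0,1\}^{n_x}$ has exactly one fixed point $w_x$. For a bit string $w$ let $\mathrm{unpad}(w)$ be obtained by removing all trailing zeros and then the last bit (a $1$) if there is one; thus $\mathrm{unpad}(y10^k)=y$ and $\mathrm{unpad}(0^k)$ is the empty string. The algorithm $\mathcal A$ *decides* $R$ if $R=\{(x,\mathrm{unpad}(w_x)) : x\in\{0,1\}^*\}$, and it *decides $R$ without padding* if $R=\{(x,w_x) : x\in\{0,1\}^*\}$.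 Let $\mathrm{FP}_{\mathrm{NCCirc}}$ be the class of binary relations decided by some deterministic NCCirc algorithm. **Theorem 3.** $\mathrm{FP}_{\mathrm{NCCirc}}=\mathrm{TFUP}$. Moreover, a binary relation is decided without padding by some deterministic NCCirc algorithm if and only if it is in $\mathrm{TFUP}$ and the length of the solution of $x$ is computable (in unary) from $x$ in polynomial time. -/

import Mathlib

namespace NCCirc

/-! ### Boolean circuits over AND, OR, NOT -/

/-- A gate, given by the numbers of the wires that it reads. -/
inductive Gate where
  | andGate (i j : ℕ)
  | orGate (i j : ℕ)
  | notGate (i : ℕ)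

namespace Gate

/-- All wires read by the gate have a number below `N`. -/
def ReadsBelow (N : ℕ) : Gate → Prop
  | andGate i j => i < N ∧ j < N
  | orGate i j => i < N ∧ j < N
  | notGate i => i < N

/-- The output bit of the gate, given the list of values of the preceding wires. -/
def eval (v : List Bool) : Gate → Bool
  | andGate i j => v.getD i false && v.getD j false
  | orGate i j => v.getD i false || v.getD j false
  | notGate i => !(v.getD i false)

end Gate

/-- A Boolean circuit with the same number `width` of input wires and of output wires.
The wires are numbered `0, 1, 2, …`: first the `width` input wires, then the wire leaving each
gate, in the order of the list `gates`. A gate reads only wires with smaller numbers than its own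
(so the circuit is acyclic), and `outputs` lists the wires that leave the circuit, in order.
No wire that a gate or an output refers to is missing, so the default value in `List.getD` is
never used. -/
structure Circuit where
  width : ℕ
  gates : List Gate
  outputs : List ℕ
  outputs_length : outputs.length = width
  gates_wf : ∀ (k : ℕ) (hk : k < gates.length), gates[k].ReadsBelow (width + k)
  outputs_wf : ∀ i ∈ outputs, i < width + gates.length

/-- The alphabet in which circuits are written down. -/
inductive Symbol where
  | tick
  | sep
  | andSym
  | orSym
  | notSym

/-- A wire number in unary, followed by an end mark. -/
def encodeNat (n : ℕ) : List Symbol :=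
  List.replicate n Symbol.tick ++ [Symbol.sep]

/-- The string describing a gate. -/
def Gate.encode : Gate → List Symbol
  | Gate.andGate i j => Symbol.andSym :: (encodeNat i ++ encodeNat j)
  | Gate.orGate i j => Symbol.orSym :: (encodeNat i ++ encodeNat j)
  | Gate.notGate i => Symbol.notSym :: encodeNat i

namespace Circuit

/-- The string describing a circuit: its width, its gates, its outputs. Every wire is an input
(so it has its own output in the description) or is produced by a gate of the description; hence
writing wire numbers in unary changes lengths only polynomially. -/
def encode (C : Circuit) : List Symbol :=
  encodeNat C.width ++ (C.gates.flatMap Gate.encode ++ C.outputs.flatMap encodeNat)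

/-- The values of all wires on the input `y`. -/
def wires (C : Circuit) (y : List Bool) : List Bool :=
  C.gates.foldl (fun v g => v ++ [g.eval v]) y

/-- The function `{0,1}ⁿ → {0,1}ⁿ` induced by a circuit with `n` input and `n` output wires. -/
def fn (C : Circuit) (y : List.Vector Bool C.width) : List.Vector Bool C.width :=
  ⟨C.outputs.map (fun i => (C.wires y.toList).getD i false), by
    rw [List.length_map, C.outputs_length]⟩

/-- The closed circuit obtained by connecting each output wire with the input wire of the same
label is logically consistent: the induced function has a unique fixed point. -/
def LogicallyConsistent (C : Circuit) : Prop :=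
  ∃! y : List.Vector Bool C.width, Function.IsFixedPt C.fn y

end Circuit

/-! ### Polynomial time -/

/-- `f` is computed by a deterministic Turing machine in time polynomial in the length of the
input, where inputs and outputs are written as strings by `ea` and `eb`. -/
def PolyTime {α β A B : Type} (ea : α → List A) (eb : β → List B) (f : α → β) : Prop :=
  Nonempty (Turing.TM2ComputableInPolyTime ea eb f)

/-- A pair of bit strings as one string, with a separator. -/
def encodePair (p : List Bool × List Bool) : List (Option Bool) :=
  p.1.map some ++ none :: p.2.map some

/-- Natural numbers in unary. -/
def encodeUnary (n : ℕ) : List Bool := List.replicate n true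

/-! ### Binary relations on bit strings and the class TFUP -/

open Classical in
/-- Membership in `R` is decided by a deterministic polynomial-time Turing machine. -/
def PolynomiallyDecidable (R : Set (List Bool × List Bool)) : Prop :=
  PolyTime encodePair Computability.encodeBool (fun p => decide (p ∈ R))

/-- Solutions are polynomially bounded in length. -/
def PolynomiallyBalanced (R : Set (List Bool × List Bool)) : Prop :=
  ∃ q : Polynomial ℕ, ∀ x y : List Bool, (x, y) ∈ R → y.length ≤ q.eval x.length

/-- Total search problems with unique solutions. -/
def TFUP : Set (Set (List Bool × List Bool)) :=
  {R | PolynomiallyDecidable R ∧ PolynomiallyBalanced R ∧ ∀ x : List Bool, ∃! y, (x, y) ∈ R}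

/-- The length of the solutions can be computed (in unary) in polynomial time. -/
def PolyTimeSolutionLength (R : Set (List Bool × List Bool)) : Prop :=
  ∃ l : List Bool → ℕ, PolyTime (fun x : List Bool => x) encodeUnary l ∧
    ∀ x y : List Bool, (x, y) ∈ R → y.length = l x

/-! ### Deterministic NCCirc algorithms -/

/-- A deterministic NCCirc algorithm: in polynomial time it maps every bit string `x` to
a circuit whose closed circuit is logically consistent. -/
structure Algorithm where
  circuit : List Bool → Circuit
  polyTime : PolyTime (fun x : List Bool => x) Circuit.encode circuit
  consistent : ∀ x, (circuit x).LogicallyConsistent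

/-- Remove the padding from a string: `y 1 0 … 0` becomes `y` (and `0 … 0` becomes empty). -/
def unpad (w : List Bool) : List Bool :=
  (w.rdropWhile (fun b => !b)).dropLast

namespace Algorithm

/-- The algorithm decides `R`, the solution for `x` being the fixed point of the circuit for `x`
with its padding removed. -/
def Decides (𝒜 : Algorithm) (R : Set (List Bool × List Bool)) : Prop :=
  ∀ x y : List Bool, (x, y) ∈ R ↔
    ∃ w : List.Vector Bool (𝒜.circuit x).width,
      Function.IsFixedPt (𝒜.circuit x).fn w ∧ unpad w.toList = y

/-- The algorithm decides `R`, the solution for `x` being the fixed point itself of the circuit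
for `x`. -/
def DecidesExactly (𝒜 : Algorithm) (R : Set (List Bool × List Bool)) : Prop :=
  ∀ x y : List Bool, (x, y) ∈ R ↔
    ∃ w : List.Vector Bool (𝒜.circuit x).width,
      Function.IsFixedPt (𝒜.circuit x).fn w ∧ w.toList = y

end Algorithm

/-- The binary relations decided by deterministic NCCirc algorithms, where solutions are padded
to the number of wires of the circuit. -/
def FPNCCirc : Set (Set (List Bool × List Bool)) :=
  {R | ∃ 𝒜 : Algorithm, 𝒜.Decides R}

/-- The binary relations decided by deterministic NCCirc algorithms, where solutions must fill all
the wires of the circuit, without padding. -/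
def FPNCCircExact : Set (Set (List Bool × List Bool)) :=
  {R | ∃ 𝒜 : Algorithm, 𝒜.DecidesExactly R}

end NCCirc

/-!
The fixed point of a circuit has the length of the circuit, and it is recognized in polynomial time
by evaluating the circuit from its description. Hence the relations decided without padding are in
`TFUP`, and their solutions have a computable length.

For the converse, let the solution of `x` have length `l x`. As in the Cook–Levin theorem, a run of
the decider of `R` on `(x, w)` is unrolled into gates, where a machine is regarded as a
one-dimensional automaton whose cells hold the symbols at the same depth in all stacks. The circuit
for `x` copies `w`, except that it flips the first bit if the decider rejects `(x, w)`; its only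
fixed point is therefore the solution. Padding all solutions to a common length reduces `TFUP` to
relations whose solutions have a computable length.

Gates are laid out so that the number of a wire is a simple arithmetic expression. That the
description of the circuit is computable in polynomial time then follows from closure properties of
the polynomial time functions, which are proved by composing stack machines.
-/

namespace NCCirc

open Function

/-! ### Programs for stack machines -/

section Programs

open Turing Turing.TM2

section Steps

variable {K : Type} {Γ : K → Type} {Λ σ : Type}

/-- The number of instructions of a statement. -/
def stmtSize : Stmt Γ Λ σ → ℕ
  | .push _ _ q | .peek _ _ q | .pop _ _ q | .load _ q => stmtSize q + 1
  | .branch _ q₁ q₂ => stmtSize q₁ + stmtSize q₂ + 1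
  | .goto _ | .halt => 1

theorem exists_stmtSize_le [Finite Λ] (m : Λ → Stmt Γ Λ σ) : ∃ C, ∀ l, stmtSize (m l) ≤ C :=
  (Set.finite_range fun l => stmtSize (m l)).bddAbove.imp fun _ hC l => hC ⟨l, rfl⟩

variable [DecidableEq K]

/-- `Steps m n c c'`: the program `m` leads from `c` to `c'` in exactly `n` steps. -/
inductive Steps (m : Λ → Stmt Γ Λ σ) : ℕ → Cfg Γ Λ σ → Cfg Γ Λ σ → Prop
  | refl (c) : Steps m 0 c c
  | head {n l v S c'} : Steps m n (stepAux (m l) v S) c' → Steps m (n + 1) ⟨some l, v, S⟩ c'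

theorem Steps.trans {m : Λ → Stmt Γ Λ σ} {n n' c c' c''} (h : Steps m n c c')
    (h' : Steps m n' c' c'') : Steps m (n + n') c c'' := by
  induction h with
  | refl => simpa only [zero_add] using h'
  | head _ ih => rw [Nat.add_right_comm]; exact .head (ih h')

theorem steps_iff_iterate_step {m : Λ → Stmt Γ Λ σ} {n c c'} :
    Steps m n c c' ↔ (flip bind (step m))^[n] (some c) = some c' := by
  have iterate_none : ∀ n, (flip bind (step m))^[n] none = none := fun n => iterate_fixed rfl n
  induction n generalizing c with
  | zero => exact ⟨fun | .refl _ => rfl, fun h => Option.some_injective _ h ▸ .refl _⟩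
  | succ n ih =>
    rw [iterate_succ_apply]
    rcases c with ⟨_ | l, v, S⟩
    · exact ⟨nofun, fun h => nomatch (iterate_none n).symm.trans h⟩
    · exact Iff.trans ⟨fun | .head h => h, .head⟩ ih

theorem length_stepAux_le (q : Stmt Γ Λ σ) (v : σ) (S : ∀ k, List (Γ k)) (k : K) :
    ((stepAux q v S).stk k).length ≤ (S k).length + stmtSize q := by
  induction q generalizing v S with
  | push k' _ q ih | pop k' _ q ih =>
    refine (ih _ _).trans ?_
    rcases eq_or_ne k k' with rfl | hk
    · simp only [update_self, List.length_cons, List.length_tail, stmtSize]; omega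
    · simp only [update_of_ne hk, stmtSize]; omega
  | peek _ _ q ih | load _ q ih => exact (ih _ _).trans (by simp only [stmtSize]; omega)
  | branch g q₁ q₂ ih₁ ih₂ =>
    simp only [stepAux]
    cases g v
    · exact (ih₂ _ _).trans (by simp only [stmtSize]; omega)
    · exact (ih₁ _ _).trans (by simp only [stmtSize]; omega)
  | goto | halt => exact Nat.le_add_right _ _

theorem Steps.length_le {m : Λ → Stmt Γ Λ σ} {C : ℕ} (hC : ∀ l, stmtSize (m l) ≤ C) {n c c'}
    (h : Steps m n c c') (k : K) : (c'.stk k).length ≤ (c.stk k).length + n * C := by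
  induction h with
  | refl => omega
  | @head n l v S c' _ ih =>
    have := length_stepAux_le (m l) v S k
    have := hC l
    simp only at ih ⊢
    rw [add_mul]; omega

/-- All stacks are empty but one. -/
abbrev single (k : K) (l : List (Γ k)) : ∀ k, List (Γ k) := update (fun _ => []) k l

theorem length_single_le (k : K) (l : List (Γ k)) (k' : K) : (single k l k').length ≤ l.length := by
  rcases eq_or_ne k' k with rfl | h
  · rw [single, update_self]
  · simp [h]

end Steps

section Machines

variable {α β A B : Type} {ea : α → List A} {eb : β → List B} {f : α → β}

theorem initList_eq (tm : FinTM2) (s) :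
    initList tm s = ⟨some tm.main, tm.initialState, single tm.k₀ s⟩ := by
  refine congrArg (Cfg.mk _ _) (funext fun k => ?_)
  by_cases h : k = tm.k₀
  · subst h; simp
  · simp [h]

theorem haltList_eq (tm : FinTM2) (s) :
    haltList tm s = ⟨none, tm.initialState, single tm.k₁ s⟩ := by
  refine congrArg (Cfg.mk _ _) (funext fun k => ?_)
  by_cases h : k = tm.k₁
  · subst h; simp
  · simp [h]

theorem polyTime_iff_exists_steps :
    PolyTime ea eb f ↔
      ∃ (tm : FinTM2) (iA : tm.Γ tm.k₀ ≃ A) (iB : tm.Γ tm.k₁ ≃ B) (p : Polynomial ℕ), ∀ a,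
        ∃ n ≤ p.eval (ea a).length,
          Steps tm.m n ⟨some tm.main, tm.initialState, single tm.k₀ ((ea a).map iA.symm)⟩
            ⟨none, tm.initialState, single tm.k₁ ((eb (f a)).map iB.symm)⟩ := by
  constructor
  · rintro ⟨M⟩
    refine ⟨M.tm, M.inputAlphabet, M.outputAlphabet, M.time, fun a => ?_⟩
    obtain ⟨⟨n, h⟩, hn⟩ := M.outputsFun a
    rw [Option.map_some, initList_eq, haltList_eq] at h
    exact ⟨n, hn, steps_iff_iterate_step.2 h⟩
  · rintro ⟨tm, iA, iB, p, h⟩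
    refine ⟨⟨⟨tm, iA, iB⟩, p, fun a => ⟨⟨(h a).choose, ?_⟩, (h a).choose_spec.1⟩⟩⟩
    rw [Option.map_some, initList_eq, haltList_eq]
    exact steps_iff_iterate_step.1 (h a).choose_spec.2

theorem PolyTime.exists_length_le (h : PolyTime ea eb f) :
    ∃ p : Polynomial ℕ, ∀ a, (eb (f a)).length ≤ p.eval (ea a).length := by
  obtain ⟨tm, iA, iB, p, h⟩ := polyTime_iff_exists_steps.1 h
  have := tm.ΛFin
  obtain ⟨C, hC⟩ := exists_stmtSize_le tm.m
  refine ⟨.X + p * .C C, fun a => ?_⟩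
  obtain ⟨n, hn, h⟩ := h a
  have output_le := h.length_le hC tm.k₁
  have input_le := length_single_le tm.k₀ ((ea a).map iA.symm) tm.k₁
  simp only [update_self, List.length_map] at output_le input_le
  simp only [Polynomial.eval_add, Polynomial.eval_X, Polynomial.eval_mul, Polynomial.eval_C]
  have := Nat.mul_le_mul_right C hn
  omega

theorem eval_mono (p : Polynomial ℕ) : Monotone fun n => p.eval n := by
  intro m n h
  induction p using Polynomial.induction_on' with
  | add p q hp hq => simpa only [Polynomial.eval_add] using add_le_add hp hq
  | monomial k a =>
    simpa only [Polynomial.eval_monomial] using Nat.mul_le_mul_left a (Nat.pow_le_pow_left h k)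

end Machines

section Embedding

variable {K₁ K : Type} {Γ₁ : K₁ → Type} {Γ : K → Type} {Λ₁ Λ σ₁ σ : Type}

/-- A way of running a program with stacks `Γ₁` as a part of one with stacks `Γ`. A state of the
larger program consists of one of the smaller program and of a rest, which is not changed. Where
the smaller program halts, the larger one goes on with the label `exit`, or halts if there is
none. -/
structure Embedding (Γ₁ : K₁ → Type) (Λ₁ σ₁ : Type) (Γ : K → Type) (Λ σ : Type) where
  stack : K₁ → K
  stack_injective : Injective stack
  symbol : ∀ k, Γ₁ k ≃ Γ (stack k)
  label : Λ₁ → Λ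
  exit : Option Λ
  Rest : Type
  state : σ₁ × Rest ≃ σ

namespace Embedding

variable (E : Embedding Γ₁ Λ₁ σ₁ Γ Λ σ)

/-- The translation of a statement of the smaller program. -/
def stmt : Stmt Γ₁ Λ₁ σ₁ → Stmt Γ Λ σ
  | .push k g q => .push (E.stack k) (fun s => E.symbol k (g (E.state.symm s).1)) (stmt q)
  | .peek k g q => .peek (E.stack k)
      (fun s o => E.state (g (E.state.symm s).1 (o.map (E.symbol k).symm), (E.state.symm s).2))
      (stmt q)
  | .pop k g q => .pop (E.stack k)
      (fun s o => E.state (g (E.state.symm s).1 (o.map (E.symbol k).symm), (E.state.symm s).2))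
      (stmt q)
  | .load g q => .load (fun s => E.state (g (E.state.symm s).1, (E.state.symm s).2)) (stmt q)
  | .branch g q₁ q₂ => .branch (fun s => g (E.state.symm s).1) (stmt q₁) (stmt q₂)
  | .goto g => .goto fun s => E.label (g (E.state.symm s).1)
  | .halt => E.exit.elim .halt fun l => .goto fun _ => l

/-- The stacks `S` of the larger program are the stacks `S₁` of the smaller program, and agree with
`T` elsewhere. -/
def Extends (T : ∀ k, List (Γ k)) (S₁ : ∀ k, List (Γ₁ k)) (S : ∀ k, List (Γ k)) : Prop :=
  (∀ k, S (E.stack k) = (S₁ k).map (E.symbol k)) ∧ ∀ k ∉ Set.range E.stack, S k = T k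

/-- A configuration of the larger program, given the label and the state of the smaller one. -/
def cfg (r : E.Rest) (l : Option Λ₁) (v : σ₁) (S : ∀ k, List (Γ k)) : Cfg Γ Λ σ :=
  ⟨(l.map E.label).or E.exit, E.state (v, r), S⟩

variable {E} {T S S' : ∀ k, List (Γ k)} {S₁ : ∀ k, List (Γ₁ k)}

theorem Extends.unique (h : E.Extends T S₁ S) (h' : E.Extends T S₁ S') : S = S' := by
  funext k
  by_cases hk : k ∈ Set.range E.stack
  · obtain ⟨k, rfl⟩ := hk
    rw [h.1, h'.1]
  · rw [h.2 k hk, h'.2 k hk]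

variable [DecidableEq K₁] [DecidableEq K]

theorem Extends.update (h : E.Extends T S₁ S) (k : K₁) (l : List (Γ₁ k)) :
    E.Extends T (update S₁ k l) (update S (E.stack k) (l.map (E.symbol k))) := by
  refine ⟨fun k' => ?_, fun k' hk' => ?_⟩
  · rcases eq_or_ne k' k with rfl | hk
    · rw [update_self, update_self]
    · rw [update_of_ne hk, update_of_ne (E.stack_injective.ne hk), h.1]
  · rw [update_of_ne fun hk => hk' ⟨k, hk.symm⟩, h.2 k' hk']

theorem Extends.stepAux (h : E.Extends T S₁ S) (q : Stmt Γ₁ Λ₁ σ₁) (v : σ₁) (r : E.Rest) :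
    ∃ S', TM2.stepAux (E.stmt q) (E.state (v, r)) S =
        E.cfg r (TM2.stepAux q v S₁).l (TM2.stepAux q v S₁).var S' ∧
      E.Extends T (TM2.stepAux q v S₁).stk S' := by
  induction q generalizing v S₁ S with
  | push k g q ih =>
    obtain ⟨S', hstep, hS'⟩ := ih (h.update k (g v :: S₁ k)) v
    refine ⟨S', ?_, hS'⟩
    rw [List.map_cons, ← h.1] at hstep
    simpa only [stmt, TM2.stepAux, Equiv.symm_apply_apply] using hstep
  | peek k g q ih =>
    obtain ⟨S', hstep, hS'⟩ := ih h (g v (S₁ k).head?)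
    refine ⟨S', ?_, hS'⟩
    simpa [stmt, TM2.stepAux, h.1, Option.map_map] using hstep
  | pop k g q ih =>
    obtain ⟨S', hstep, hS'⟩ := ih (h.update k (S₁ k).tail) (g v (S₁ k).head?)
    refine ⟨S', ?_, hS'⟩
    simpa [stmt, TM2.stepAux, h.1, Option.map_map] using hstep
  | load g q ih =>
    obtain ⟨S', hstep, hS'⟩ := ih h (g v)
    refine ⟨S', ?_, hS'⟩
    simpa only [stmt, TM2.stepAux, Equiv.symm_apply_apply] using hstep
  | branch g q₁ q₂ ih₁ ih₂ =>
    simp only [stmt, TM2.stepAux, Equiv.symm_apply_apply]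
    cases g v
    exacts [ih₂ h v, ih₁ h v]
  | goto g => exact ⟨S, by simp [stmt, cfg], h⟩
  | halt => exact ⟨S, by cases hE : E.exit <;> simp [stmt, cfg, hE], h⟩

theorem steps {m₁ : Λ₁ → Stmt Γ₁ Λ₁ σ₁} {m : Λ → Stmt Γ Λ σ}
    (hm : ∀ l, m (E.label l) = E.stmt (m₁ l)) {n c c'} (h : Steps m₁ n c c') (r : E.Rest)
    (hS : E.Extends T c.stk S) (hS' : E.Extends T c'.stk S') :
    Steps m n (E.cfg r c.l c.var S) (E.cfg r c'.l c'.var S') := by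
  induction h generalizing S with
  | refl c => rw [hS.unique hS']; exact .refl _
  | @head n l v S₁ c' _ ih =>
    obtain ⟨S'', hstep, hS''⟩ := hS.stepAux (m₁ l) v r
    refine .head ?_
    rw [hm, hstep]
    exact ih hS'' hS'

end Embedding

end Embedding

section Family

variable {R R' : Type} {Γ : R → Type} {Δ : R' → Type}

/-- Two families of alphabets side by side. This is `Sum.elim`, made reducible. -/
abbrev SumFamily (Γ : R → Type) (Δ : R' → Type) : R ⊕ R' → Type
  | .inl r => Γ r
  | .inr r => Δ r

/-- Two families of stacks side by side. -/
def join (S : ∀ r, List (Γ r)) (T : ∀ r, List (Δ r)) : ∀ r, List (SumFamily Γ Δ r)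
  | .inl r => S r
  | .inr r => T r

variable (S : ∀ r, List (Γ r)) (T : ∀ r, List (Δ r))

@[simp] theorem join_inl (r : R) : join S T (.inl r) = S r := rfl

@[simp] theorem join_inr (r : R') : join S T (.inr r) = T r := rfl

variable [DecidableEq R] [DecidableEq R']

@[simp] theorem update_join_inl (r : R) (l : List (Γ r)) :
    update (join S T) (.inl r) l = join (update S r l) T := by
  funext k
  rcases k with k | k
  · rcases eq_or_ne k r with rfl | h
    · simp only [update_self, join_inl]
    · rw [update_of_ne (Sum.inl_injective.ne h), join_inl, join_inl, update_of_ne h]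
  · rw [update_of_ne Sum.inr_ne_inl, join_inr, join_inr]

@[simp] theorem update_join_inr (r : R') (l : List (Δ r)) :
    update (join S T) (.inr r) l = join S (update T r l) := by
  funext k
  rcases k with k | k
  · rw [update_of_ne Sum.inl_ne_inr, join_inl, join_inl]
  · rcases eq_or_ne k r with rfl | h
    · simp only [update_self, join_inr]
    · rw [update_of_ne (Sum.inr_injective.ne h), join_inr, join_inr, update_of_ne h]

end Family

/-- A program with registers over the alphabets `Γ`. It may use auxiliary stacks, which are empty
at the beginning and in the end. -/
structure Program {R : Type} (Γ : R → Type) where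
  Aux : Type
  [decidableEqAux : DecidableEq Aux]
  [finiteAux : Finite Aux]
  alphabet : Aux → Type
  Label : Type
  [finiteLabel : Finite Label]
  main : Label
  State : Type
  [finiteState : Finite State]
  start : State
  code : Label → Stmt (SumFamily Γ alphabet) Label State

attribute [instance] Program.decidableEqAux Program.finiteAux Program.finiteLabel
  Program.finiteState

namespace Program

variable {R R' : Type} {Γ : R → Type} {Δ : R' → Type}

/-- The first program of a sequential composition as a part of it. -/
def seqLeft (P Q : Program Γ) : Embedding (SumFamily Γ P.alphabet) P.Label P.State
    (SumFamily Γ (SumFamily P.alphabet Q.alphabet)) (P.Label ⊕ Q.Label) (P.State × Q.State) where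
  stack := Sum.map id .inl
  stack_injective := injective_id.sumMap Sum.inl_injective
  symbol | .inl _ | .inr _ => .refl _
  label := .inl
  exit := some (.inr Q.main)
  Rest := Q.State
  state := .refl _

/-- The second program of a sequential composition as a part of it. -/
def seqRight (P Q : Program Γ) : Embedding (SumFamily Γ Q.alphabet) Q.Label Q.State
    (SumFamily Γ (SumFamily P.alphabet Q.alphabet)) (P.Label ⊕ Q.Label) (P.State × Q.State) where
  stack := Sum.map id .inr
  stack_injective := injective_id.sumMap Sum.inr_injective
  symbol | .inl _ | .inr _ => .refl _
  label := .inr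
  exit := none
  Rest := P.State
  state := .prodComm _ _

/-- Run `P`, then `Q`. -/
abbrev seq (P Q : Program Γ) : Program Γ where
  Aux := P.Aux ⊕ Q.Aux
  alphabet := SumFamily P.alphabet Q.alphabet
  Label := P.Label ⊕ Q.Label
  main := .inl P.main
  State := P.State × Q.State
  start := (P.start, Q.start)
  code := Sum.elim (fun l => (seqLeft P Q).stmt (P.code l)) fun l => (seqRight P Q).stmt (Q.code l)

theorem seqLeft_extends (P Q : Program Γ) (S : ∀ r, List (Γ r)) :
    (seqLeft P Q).Extends (fun _ => []) (join S fun _ => []) (join S fun _ => []) := by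
  refine ⟨?_, by rintro (_ | _ | _) <;> simp [seqLeft]⟩
  rintro (_ | _)
  exacts [(List.map_id _).symm, rfl]

theorem seqRight_extends (P Q : Program Γ) (S : ∀ r, List (Γ r)) :
    (seqRight P Q).Extends (fun _ => []) (join S fun _ => []) (join S fun _ => []) := by
  refine ⟨?_, by rintro (_ | _ | _) <;> simp [seqRight]⟩
  rintro (_ | _)
  exacts [(List.map_id _).symm, rfl]

/-- A program with its registers `Δ` regarded as auxiliary stacks. -/
def hideEmbedding (P : Program (SumFamily Γ Δ)) :
    Embedding (SumFamily (SumFamily Γ Δ) P.alphabet) P.Label P.State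
      (SumFamily Γ (SumFamily Δ P.alphabet)) P.Label P.State where
  stack := Equiv.sumAssoc _ _ _
  stack_injective := Equiv.injective _
  symbol | .inl (.inl _) | .inl (.inr _) | .inr _ => .refl _
  label := id
  exit := none
  Rest := Unit
  state := .prodPUnit _

/-- Turn the registers `Δ` into auxiliary stacks. -/
abbrev hide [DecidableEq R'] [Finite R'] (P : Program (SumFamily Γ Δ)) : Program Γ where
  Aux := R' ⊕ P.Aux
  alphabet := SumFamily Δ P.alphabet
  Label := P.Label
  main := P.main
  State := P.State
  start := P.start
  code l := (hideEmbedding P).stmt (P.code l)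

theorem hideEmbedding_extends (P : Program (SumFamily Γ Δ)) (S : ∀ r, List (Γ r)) :
    (hideEmbedding P).Extends (fun _ => []) (join (join S fun _ => []) fun _ => [])
      (join S fun _ => []) := by
  refine ⟨?_, by simp [hideEmbedding]⟩
  rintro ((_ | _) | _)
  exacts [(List.map_id _).symm, rfl, rfl]

/-- The body of a loop as a part of it. -/
def loopEmbedding (P : Program Γ) : Embedding (SumFamily Γ P.alphabet) P.Label P.State
    (SumFamily Γ P.alphabet) (Unit ⊕ P.Label) (P.State × Bool) where
  stack := id
  stack_injective := injective_id
  symbol _ := .refl _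
  label := .inr
  exit := some (.inl ())
  Rest := Bool
  state := .refl _

/-- While there is a symbol in register `r`, remove it and run `P`. -/
abbrev loop (r : R) (P : Program Γ) : Program Γ where
  Aux := P.Aux
  alphabet := P.alphabet
  Label := Unit ⊕ P.Label
  main := .inl ()
  State := P.State × Bool
  start := (P.start, false)
  code := Sum.elim
    (fun _ => .pop (.inl r) (fun s o => (s.1, o.isSome)) <|
      .branch Prod.snd (.goto fun _ => .inr P.main) .halt)
    (fun l => (loopEmbedding P).stmt (P.code l))

theorem loopEmbedding_extends (P : Program Γ) (S : ∀ r, List (SumFamily Γ P.alphabet r)) :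
    (loopEmbedding P).Extends (fun _ => []) S S :=
  ⟨fun _ => (List.map_id _).symm, fun _ h => (h ⟨_, rfl⟩).elim⟩

variable [DecidableEq R]

/-- The program, started on the registers `S`, ends with the registers `S'` after at most `t` steps
and in the state in which it has started. -/
def Runs (P : Program Γ) (t : ℕ) (S S' : ∀ r, List (Γ r)) : Prop :=
  ∃ n ≤ t, Steps P.code n ⟨some P.main, P.start, join S fun _ => []⟩
    ⟨none, P.start, join S' fun _ => []⟩

theorem Runs.mono {P : Program Γ} {t t' S S'} (h : P.Runs t S S') (ht : t ≤ t') : P.Runs t' S S' :=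
  h.imp fun _ h => ⟨h.1.trans ht, h.2⟩

theorem Runs.seq {P Q : Program Γ} {t t' S S' S''} (hP : P.Runs t S S') (hQ : Q.Runs t' S' S'') :
    (P.seq Q).Runs (t + t') S S'' := by
  obtain ⟨n, hn, hP⟩ := hP
  obtain ⟨n', hn', hQ⟩ := hQ
  have hleft := (seqLeft P Q).steps (m := (P.seq Q).code) (fun _ => rfl) hP Q.start
    (seqLeft_extends P Q S) (seqLeft_extends P Q S')
  have hright := (seqRight P Q).steps (m := (P.seq Q).code) (fun _ => rfl) hQ P.start
    (seqRight_extends P Q S') (seqRight_extends P Q S'')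
  exact ⟨n + n', add_le_add hn hn', hleft.trans hright⟩

theorem Runs.hide [DecidableEq R'] [Finite R'] {P : Program (SumFamily Γ Δ)} {t : ℕ}
    {S S' : ∀ r, List (Γ r)} (h : P.Runs t (join S fun _ => []) (join S' fun _ => [])) :
    P.hide.Runs t S S' := by
  obtain ⟨n, hn, h⟩ := h
  exact ⟨n, hn, (hideEmbedding P).steps (m := P.hide.code) (fun _ => rfl) h ()
    (hideEmbedding_extends P S) (hideEmbedding_extends P S')⟩

theorem Runs.loop {r : R} {P : Program Γ} {t n : ℕ} (S : ℕ → ∀ r, List (Γ r))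
    (hP : ∀ i < n, S i r ≠ [] ∧ P.Runs t (update (S i) r (S i r).tail) (S (i + 1)))
    (hn : S n r = []) : (loop r P).Runs (n * (t + 1) + 1) (S 0) (S n) := by
  suffices ∀ b, ∃ n' ≤ n * (t + 1) + 1, Steps (Program.loop r P).code n'
      ⟨some (.inl ()), (P.start, b), join (S 0) fun _ => []⟩
      ⟨none, (P.start, false), join (S n) fun _ => []⟩ from this false
  induction n generalizing S with
  | zero =>
    refine fun b => ⟨1, by omega, .head ?_⟩
    have test_fails : stepAux ((Program.loop r P).code (.inl ())) (P.start, b)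
        (join (S 0) fun _ => []) = ⟨none, (P.start, false), join (S 0) fun _ => []⟩ := by
      have hS : update (S 0) r [] = S 0 := by rw [← hn, update_eq_self]
      simp [hn, hS]
    rw [test_fails]
    exact .refl _
  | succ n ih =>
    intro b
    obtain ⟨hne, n₁, hn₁, hbody⟩ := hP 0 n.succ_pos
    obtain ⟨n₂, hn₂, hrest⟩ := ih (fun i => S (i + 1)) (fun i hi => hP _ (by omega)) hn true
    have hbody' := (loopEmbedding P).steps (m := (Program.loop r P).code) (fun _ => rfl) hbody true
      (loopEmbedding_extends P _) (loopEmbedding_extends P _)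
    have test_succeeds : stepAux ((Program.loop r P).code (.inl ())) (P.start, b)
        (join (S 0) fun _ => []) = ⟨some (.inr P.main), (P.start, true),
          join (update (S 0) r (S 0 r).tail) fun _ => []⟩ := by
      obtain ⟨y, l, hy⟩ := List.exists_cons_of_ne_nil hne
      simp [hy]
    refine ⟨n₁ + n₂ + 1, by rw [add_mul]; omega, .head (.trans ?_ hrest)⟩
    rw [test_succeeds]
    exact hbody'

end Program

section Mealy

variable {Q A B : Type}

/-- The output of a finite automaton, which may write a letter whenever it reads one, and once more
(this is `out q none`) at the end of the input. -/
def mealy (δ : Q → A → Q) (out : Q → Option A → Option B) : Q → List A → List B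
  | q, [] => (out q none).toList
  | q, a :: l => (out q (some a)).toList ++ mealy δ out (δ q a) l

theorem length_mealy_le (δ : Q → A → Q) (out : Q → Option A → Option B) (q : Q) (l : List A) :
    (mealy δ out q l).length ≤ l.length + 1 := by
  have length_toList_le (o : Option B) : o.toList.length ≤ 1 := by cases o <;> simp
  induction l generalizing q with
  | nil => exact length_toList_le _
  | cons a l ih =>
    rw [mealy, List.length_append, List.length_cons, add_comm]
    exact add_le_add (ih _) (length_toList_le _)

theorem mealy_eq_filterMap {δ : Q → A → Q} (φ : Q → A → Option B) {q : Q} {l : List A}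
    (hδ : ∀ a ∈ l, δ q a = q) : mealy δ (fun q x => x.bind (φ q)) q l = l.filterMap (φ q) := by
  induction l with
  | nil => rfl
  | cons a l ih =>
    obtain ⟨ha, hl⟩ := List.forall_mem_cons.1 hδ
    rw [mealy, ha, ih hl, List.filterMap_cons]
    cases h : φ q a <;> simp [h]

theorem reverse_toList (o : Option A) : o.toList.reverse = o.toList := by cases o <;> rfl

theorem reverse_mealy_cons (δ : Q → A → Q) (out : Q → Option A → Option B) (q : Q) (a : A)
    (l : List A) : (mealy δ out q (a :: l)).reverse =
      (mealy δ out (δ q a) l).reverse ++ (out q (some a)).toList := by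
  rw [mealy, List.reverse_append, reverse_toList]

end Mealy

/-- The registers `S` after register `a` has been emptied and `l` has been put in front of
register `b`. -/
def transfer {R : Type} [DecidableEq R] {Γ : R → Type} (S : ∀ r, List (Γ r)) (a b : R)
    (l : List (Γ b)) : ∀ r, List (Γ r) :=
  update (update S a []) b (l ++ update S a [] b)

theorem transfer_single {R : Type} [DecidableEq R] {Γ : R → Type} (a b : R) (l : List (Γ a))
    (l' : List (Γ b)) : transfer (single a l) a b l' = single b l' := by
  simp [transfer, single]

section TransferJoin

variable {R R' : Type} [DecidableEq R] [DecidableEq R'] {Γ : R → Type} {Δ : R' → Type}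
  (S : ∀ r, List (Γ r)) (T : ∀ r, List (Δ r)) (a : R) (b : R')

theorem transfer_join_inl_inr (l : List (Δ b)) :
    transfer (join S T) (.inl a) (.inr b) l = join (update S a []) (update T b (l ++ T b)) := by
  rw [transfer, update_join_inl, update_join_inr, join_inr]

theorem transfer_join_inr_inl (l : List (Γ a)) :
    transfer (join S T) (.inr b) (.inl a) l = join (update S a (l ++ S a)) (update T b []) := by
  rw [transfer, update_join_inr, update_join_inl, join_inl]

end TransferJoin

namespace Program

section Scan

variable {R : Type} {Γ : R → Type} {Aux : Type} {Δ : Aux → Type} {Λ σ Q : Type}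

open Classical in
/-- Push on each of the registers `rs` the symbol that `o` assigns to the state, if there is one. -/
noncomputable def pushEach (o : σ → ∀ r, Option (Γ r)) (q : Stmt (SumFamily Γ Δ) Λ σ) :
    List R → Stmt (SumFamily Γ Δ) Λ σ
  | [] => q
  | r :: rs =>
    if h : Nonempty (Γ r) then
      .branch (fun s => (o s r).isSome)
        (.push (.inl r) (fun s => (o s r).getD h.some) (pushEach o q rs)) (pushEach o q rs)
    else pushEach o q rs

/-- Read a symbol from the register `a`, as part of the program `scan`. -/
noncomputable def scanBody [Fintype R] (a : R) (δ : Q → Γ a → Q)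
    (out : Q → Option (Γ a) → ∀ r, Option (Γ r)) (q₀ : Q) :
    Stmt (SumFamily Γ Δ) Unit (Q × Option (Γ a)) :=
  .pop (.inl a) (fun s x => (s.1, x)) <|
    pushEach (fun s => out s.1 s.2)
      (.branch (fun s => s.2.isSome) (.load (fun s => (s.2.elim s.1 (δ s.1), none)) (.goto default))
        (.load (fun _ => (q₀, none)) .halt))
      Finset.univ.toList

/-- Read the register `a` from its beginning to its end, in the manner of a finite automaton whose
output is pushed on the registers. -/
noncomputable abbrev scan [Fintype R] [Finite Q] (a : R) [Finite (Γ a)] (δ : Q → Γ a → Q)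
    (out : Q → Option (Γ a) → ∀ r, Option (Γ r)) (q₀ : Q) : Program Γ where
  Aux := Empty
  alphabet := Empty.elim
  Label := Unit
  main := ()
  State := Q × Option (Γ a)
  start := (q₀, none)
  code _ := scanBody a δ out q₀

variable [DecidableEq R] [DecidableEq Aux]

theorem stepAux_pushEach (o : σ → ∀ r, Option (Γ r)) (q : Stmt (SumFamily Γ Δ) Λ σ) {rs : List R}
    (hrs : rs.Nodup) (s : σ) (S : ∀ r, List (Γ r)) (T : ∀ k, List (Δ k)) :
    stepAux (pushEach o q rs) s (join S T) =
      stepAux q s (join (fun r => if r ∈ rs then (o s r).toList ++ S r else S r) T) := by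
  induction rs generalizing S with
  | nil => simp [pushEach]
  | cons r rs ih =>
    have push_eq : stepAux (pushEach o q (r :: rs)) s (join S T) =
        stepAux (pushEach o q rs) s (join (update S r ((o s r).toList ++ S r)) T) := by
      rw [pushEach]
      split_ifs with hΓ
      · cases h : o s r <;> simp [stepAux, h]
      · have : o s r = none := Option.eq_none_iff_forall_ne_some.2 fun x => (hΓ ⟨x⟩).elim
        simp [this]
    rw [push_eq, ih hrs.of_cons]
    congr 2
    funext r'
    rcases eq_or_ne r' r with rfl | h
    · simp [(List.nodup_cons.1 hrs).1]
    · simp [h]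

theorem stepAux_scanBody [Fintype R] (a : R) (δ : Q → Γ a → Q)
    (out : Q → Option (Γ a) → ∀ r, Option (Γ r)) (q₀ q : Q) (x : Option (Γ a))
    (S : ∀ r, List (Γ r)) (T : ∀ k, List (Δ k)) :
    stepAux (scanBody a δ out q₀) (q, x) (join S T) =
      ⟨(S a).head?.map fun _ => (), (S a).head?.elim (q₀, none) fun y => (δ q y, none),
        join (fun r => (out q (S a).head? r).toList ++ update S a (S a).tail r) T⟩ := by
  rw [scanBody, stepAux, join_inl, update_join_inl, stepAux_pushEach _ _ (Finset.nodup_toList _)]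
  cases h : S a <;> simp [stepAux]

theorem Runs.scan [Fintype R] [Finite Q] {a : R} [Finite (Γ a)] {δ : Q → Γ a → Q}
    {out : Q → Option (Γ a) → ∀ r, Option (Γ r)} {q₀ : Q} (hout : ∀ q x, out q x a = none)
    (S : ∀ r, List (Γ r)) :
    (scan a δ out q₀).Runs ((S a).length + 1) S
      fun r => (mealy δ (fun q x => out q x r) q₀ (S a)).reverse ++ update S a [] r := by
  generalize hl : S a = l
  suffices ∀ q x, Steps (Program.scan a δ out q₀).code (l.length + 1)
      ⟨some (), (q, x), join S fun _ => []⟩ ⟨none, (q₀, none),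
        join (fun r => (mealy δ (fun q x => out q x r) q l).reverse ++ update S a [] r) fun _ => []⟩
    from ⟨_, le_rfl, this q₀ none⟩
  induction l generalizing S with
  | nil =>
    refine fun q x => .head ?_
    simpa [stepAux_scanBody, hl, mealy, reverse_toList] using Steps.refl _
  | cons y l ih =>
    refine fun q x => .head ?_
    have hrest := ih (fun r => (out q (some y) r).toList ++ update S a l r) (by simp [hout])
      (δ q y) none
    have registers_eq (r : R) : (mealy δ (fun q x => out q x r) q (y :: l)).reverse ++
          update S a [] r = (mealy δ (fun q x => out q x r) (δ q y) l).reverse ++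
          update (fun r => (out q (some y) r).toList ++ update S a l r) a [] r := by
      rw [reverse_mealy_cons]
      rcases eq_or_ne r a with rfl | h
      · simp [hout]
      · simp [h]
    simpa only [stepAux_scanBody, hl, List.length_cons, List.head?_cons, List.tail_cons,
      Option.map_some, Option.elim_some, registers_eq] using hrest

end Scan


variable {R : Type} [Fintype R] [DecidableEq R] {Γ : R → Type}

/-- Pop all symbols from the register `a` and push their images under `φ` on the registers. -/
noncomputable def pour (a : R) [Finite (Γ a)] (φ : Γ a → ∀ r, Option (Γ r)) : Program Γ :=
  scan a (fun q _ => q) (fun _ x r => x.bind (φ · r)) ()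

theorem Runs.pour {a : R} [Finite (Γ a)] {φ : Γ a → ∀ r, Option (Γ r)} (hφ : ∀ x, φ x a = none)
    {S S' : ∀ r, List (Γ r)}
    (hS' : ∀ r, S' r = ((S a).filterMap (φ · r)).reverse ++ update S a [] r) :
    (pour a φ).Runs ((S a).length + 1) S S' := by
  convert Runs.scan (a := a) (δ := fun q _ => q) (q₀ := ())
    (out := fun _ x r => x.bind (φ · r)) (fun _ x => by cases x <;> simp [hφ]) S using 1
  · rfl
  · funext r
    rw [hS', mealy_eq_filterMap (fun _ => (φ · r)) fun _ _ => rfl]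

/-- Empty the register `a` and put the images of its symbols under `φ` in front of the registers,
in the same order, after having reversed the register on an auxiliary stack. -/
noncomputable def distribute (a : R) [Finite (Γ a)] (φ : Γ a → ∀ r, Option (Γ r)) : Program Γ :=
  hide <| (pour (Γ := SumFamily Γ fun _ : Unit => Γ a) (.inl a)
      fun x => fun | .inl _ => none | .inr _ => some x).seq
    (pour (Γ := SumFamily Γ fun _ : Unit => Γ a) (.inr ())
      fun x => fun | .inl r => φ x r | .inr _ => none)

theorem Runs.distribute {a : R} [Finite (Γ a)] {φ : Γ a → ∀ r, Option (Γ r)}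
    {S S' : ∀ r, List (Γ r)} (hS' : ∀ r, S' r = (S a).filterMap (φ · r) ++ update S a [] r) :
    (distribute a φ).Runs (2 * ((S a).length + 1)) S S' := by
  have hreverse := Runs.pour (Γ := SumFamily Γ fun _ : Unit => Γ a) (a := .inl a)
    (φ := fun x => fun | .inl _ => none | .inr _ => some x) (fun _ => rfl)
    (S := join S fun _ => []) (S' := join (update S a []) fun _ => (S a).reverse)
    (by rintro (r | r) <;> simp)
  have hpush := Runs.pour (Γ := SumFamily Γ fun _ : Unit => Γ a) (a := .inr ())
    (φ := fun x => fun | .inl r => φ x r | .inr _ => none) (fun _ => rfl)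
    (S := join (update S a []) fun _ => (S a).reverse) (S' := join S' fun _ => [])
    (by rintro (r | r) <;> simp [hS', ← List.filterMap_reverse])
  refine .hide ((hreverse.seq hpush).mono ?_)
  simp only [join_inl, join_inr, List.length_reverse]
  omega

/-- Empty the register `a` and put its contents, written with other symbols, in front of the
register `b`. -/
noncomputable def move (a b : R) [Finite (Γ a)] (φ : Γ a → Γ b) : Program Γ :=
  distribute a fun x => update (fun _ => none) b (some (φ x))

theorem Runs.move {a b : R} [Finite (Γ a)] (φ : Γ a → Γ b) (S : ∀ r, List (Γ r)) :
    (move a b φ).Runs (2 * ((S a).length + 1)) S (transfer S a b ((S a).map φ)) := by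
  refine Runs.distribute fun r => ?_
  rcases eq_or_ne r b with rfl | h
  · simp [transfer]
  · simp [transfer, h]

end Program

section Machine

variable {R : Type} [DecidableEq R] {Γ : R → Type}

/-- A machine as a part of a program that has its stacks among its registers. -/
def machineEmbedding (Γ : R → Type) (tm : FinTM2) : Embedding tm.Γ tm.Λ tm.σ
    (SumFamily (SumFamily Γ tm.Γ) (Empty.elim : Empty → Type)) tm.Λ tm.σ where
  stack k := .inl (.inr k)
  stack_injective := Sum.inl_injective.comp Sum.inr_injective
  symbol _ := .refl _
  label := id
  exit := none
  Rest := Unit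
  state := .prodPUnit _

/-- A machine as a program that has its stacks among its registers. -/
abbrev Program.ofMachine (Γ : R → Type) (tm : FinTM2) : Program (SumFamily Γ tm.Γ) where
  Aux := Empty
  alphabet := Empty.elim
  Label := tm.Λ
  finiteLabel := @Finite.of_fintype _ tm.ΛFin
  main := tm.main
  State := tm.σ
  finiteState := @Finite.of_fintype _ tm.σFin
  start := tm.initialState
  code l := (machineEmbedding Γ tm).stmt (tm.m l)

theorem Program.runs_ofMachine {tm : FinTM2} {n : ℕ} {T T' : ∀ k, List (tm.Γ k)}
    (h : Steps tm.m n ⟨some tm.main, tm.initialState, T⟩ ⟨none, tm.initialState, T'⟩)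
    (S : ∀ r, List (Γ r)) : (ofMachine Γ tm).Runs n (join S T) (join S T') := by
  have extends_join (T : ∀ k, List (tm.Γ k)) : (machineEmbedding Γ tm).Extends
      (join (join S fun _ => []) fun _ => []) T (join (join S T) fun _ => []) := by
    refine ⟨fun _ => (List.map_id _).symm, ?_⟩
    rintro ((r | k) | e) hr
    · rfl
    · exact (hr ⟨k, rfl⟩).elim
    · rfl
  exact ⟨n, le_rfl, (machineEmbedding Γ tm).steps (m := (ofMachine Γ tm).code) (fun _ => rfl) h ()
    (extends_join T) (extends_join T')⟩

variable {α β A B : Type} {ea : α → List A} {eb : β → List B} {f : α → β}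

theorem PolyTime.exists_program [Finite R] [Finite B] (hf : PolyTime ea eb f) (a b : R)
    [Finite (Γ a)] (φ : Γ a → A) (ψ : B → Γ b) :
    ∃ (P : Program Γ) (p : Polynomial ℕ), ∀ x S, (S a).map φ = ea x →
      P.Runs (p.eval (ea x).length) S (transfer S a b ((eb (f x)).map ψ)) := by
  obtain ⟨q, hq⟩ := hf.exists_length_le
  obtain ⟨tm, iA, iB, p, hM⟩ := polyTime_iff_exists_steps.1 hf
  have := tm.kFin
  have := Fintype.ofFinite R
  have : Finite (SumFamily Γ tm.Γ (.inr tm.k₁)) := .of_equiv _ iB.symm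
  let load : Program (SumFamily Γ tm.Γ) := .move (.inl a) (.inr tm.k₀) fun x => iA.symm (φ x)
  let unload : Program (SumFamily Γ tm.Γ) := .move (.inr tm.k₁) (.inl b) fun x => ψ (iB x)
  refine ⟨((load.seq (.ofMachine Γ tm)).seq unload).hide, 2 * (.X + 1) + p + 2 * (q + 1),
    fun x S hx => .hide ?_⟩
  have hload := Program.Runs.move (Γ := SumFamily Γ tm.Γ) (a := .inl a) (b := .inr tm.k₀)
    (fun x => iA.symm (φ x)) (join S fun _ => [])
  have hunload := Program.Runs.move (Γ := SumFamily Γ tm.Γ) (a := .inr tm.k₁) (b := .inl b)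
    (fun x => ψ (iB x)) (join (update S a []) (single tm.k₁ ((eb (f x)).map iB.symm)))
  obtain ⟨n, hn, hsteps⟩ := hM x
  have hrun := Program.runs_ofMachine hsteps (update S a [])
  have hlength : (S a).length = (ea x).length := by rw [← hx, List.length_map]
  have hloaded : transfer (join S fun _ => []) (.inl a) (.inr tm.k₀)
      ((S a).map fun x => iA.symm (φ x)) =
      join (update S a []) (single tm.k₀ ((ea x).map iA.symm)) := by
    rw [transfer_join_inl_inr, ← hx, List.map_map, List.append_nil]
    rfl
  have hunloaded : transfer (join (update S a []) (single tm.k₁ ((eb (f x)).map iB.symm)))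
      (.inr tm.k₁) (.inl b) (((eb (f x)).map iB.symm).map fun x => ψ (iB x)) =
      join (transfer S a b ((eb (f x)).map ψ)) fun _ => [] := by
    rw [transfer_join_inr_inl, List.map_map]
    simp [transfer, single, comp_def]
  simp only [join_inl, join_inr, single, update_self, List.length_map] at hload hunload
  rw [hloaded] at hload
  rw [hunloaded] at hunload
  refine ((hload.seq hrun).seq hunload).mono ?_
  have := hq x
  simp only [hlength, Polynomial.eval_add, Polynomial.eval_mul, Polynomial.eval_X,
    Polynomial.eval_one, Polynomial.eval_ofNat]
  omega

end Machine

section Functions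

variable {α β γ A B C : Type} {ea : α → List A} {eb : β → List B} {ec : γ → List C} {f : α → β}

theorem join_single {R R' : Type} [DecidableEq R] [DecidableEq R'] {Γ : R → Type} {Δ : R' → Type}
    (a : R) (l : List (Γ a)) : join (Δ := Δ) (single a l) (fun _ => []) = single (.inl a) l := by
  have join_nil : join (fun r => ([] : List (Γ r))) (fun r => ([] : List (Δ r))) = fun _ => [] := by
    funext r
    rcases r with r | r <;> rfl
  rw [single, ← update_join_inl, join_nil]

theorem PolyTime.of_program {R : Type} [Finite R] [DecidableEq R] {Γ : R → Type} (P : Program Γ)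
    (a b : R) [Finite (Γ a)] {ea : α → List (Γ a)} {eb : β → List (Γ b)} (p : Polynomial ℕ)
    (h : ∀ x, P.Runs (p.eval (ea x).length) (single a (ea x)) (single b (eb (f x)))) :
    PolyTime ea eb f := by
  have := Fintype.ofFinite R
  have := Fintype.ofFinite P.Aux
  have := Fintype.ofFinite P.Label
  have := Fintype.ofFinite P.State
  have : Fintype (SumFamily Γ P.alphabet (.inl a)) := Fintype.ofFinite (Γ a)
  let tm : FinTM2 := ⟨.inl a, .inl b, SumFamily Γ P.alphabet, P.Label, P.main, P.State, P.start,
    P.code⟩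
  refine polyTime_iff_exists_steps.2 ⟨tm, .refl _, .refl _, p, fun x => ?_⟩
  obtain ⟨n, hn, hsteps⟩ := h x
  rw [join_single, join_single] at hsteps
  refine ⟨n, hn, ?_⟩
  rw [Equiv.refl_symm]
  simpa [tm] using hsteps

/-- Three registers. -/
abbrev Triple (A B C : Type) : Fin 3 → Type
  | 0 => A
  | 1 => B
  | 2 => C

/-- Contents of three registers. -/
def triple (l : List A) (l' : List B) (l'' : List C) : ∀ r, List (Triple A B C r)
  | 0 => l
  | 1 => l'
  | 2 => l''

theorem single_zero_eq_triple (l : List A) : single (Γ := Triple A B C) 0 l = triple l [] [] := by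
  funext r; fin_cases r <;> rfl

theorem single_two_eq_triple (l : List C) : single (Γ := Triple A B C) 2 l = triple [] [] l := by
  funext r; fin_cases r <;> rfl

theorem PolyTime.mealy {Q : Type} [Finite Q] [Finite A] [Finite B] (δ : Q → A → Q)
    (out : Q → Option A → Option B) (q₀ : Q)
    (h : ∀ x, eb (f x) = NCCirc.mealy δ out q₀ (ea x)) : PolyTime ea eb f := by
  let scan : Program (Triple A B B) := .scan 0 δ (fun q x => fun | 1 => out q x | 0 | 2 => none) q₀
  let reverse : Program (Triple A B B) := .pour 1 fun x => fun | 2 => some x | 0 | 1 => none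
  refine .of_program (scan.seq reverse) 0 2 (2 * .X + 3) fun x => ?_
  have mealy_none {B' : Type} (q : Q) :
      ∀ l, NCCirc.mealy δ (fun _ _ => (none : Option B')) q l = [] := by
    intro l
    induction l generalizing q with
    | nil => rfl
    | cons _ _ ih => exact ih _
  have hscan : scan.Runs ((ea x).length + 1) (triple (ea x) [] []) (triple [] (eb (f x)).reverse [])
      := by
    convert Program.Runs.scan (Γ := Triple A B B) (a := 0) (δ := δ) (q₀ := q₀)
      (out := fun q x => fun | 1 => out q x | 0 | 2 => none) (fun _ _ => rfl)
      (triple (ea x) [] []) using 1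
    · rfl
    · funext r
      fin_cases r <;> simp [triple, h, mealy_none]
  have hreverse : reverse.Runs ((eb (f x)).reverse.length + 1) (triple [] (eb (f x)).reverse [])
      (triple [] [] (eb (f x))) :=
    Program.Runs.pour (Γ := Triple A B B) (a := 1) (S := triple [] (eb (f x)).reverse [])
      (fun _ => rfl) fun r => by fin_cases r <;> simp [triple]
  rw [single_zero_eq_triple, single_two_eq_triple]
  refine (hscan.seq hreverse).mono ?_
  have := length_mealy_le δ out q₀ (ea x)
  simp only [h, List.length_reverse, Polynomial.eval_add, Polynomial.eval_mul,
    Polynomial.eval_X, Polynomial.eval_ofNat]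
  omega

theorem PolyTime.comp {g : β → γ} [Finite A] [Finite B] [Finite C] (hg : PolyTime eb ec g)
    (hf : PolyTime ea eb f) : PolyTime ea ec (fun x => g (f x)) := by
  obtain ⟨P, p, hP⟩ := hf.exists_program (Γ := Triple A B C) 0 1 id id
  obtain ⟨Q, q, hQ⟩ := hg.exists_program (Γ := Triple A B C) 1 2 id id
  obtain ⟨r, hr⟩ := hf.exists_length_le
  refine .of_program (P.seq Q) 0 2 (p + q.comp r) fun x => ?_
  have hPx := hP x (single 0 (ea x)) (List.map_id _)
  have hQx := hQ (f x) (single 1 (eb (f x))) (List.map_id _)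
  rw [transfer_single, List.map_id] at hPx hQx
  refine (hPx.seq hQx).mono ?_
  rw [Polynomial.eval_add, Polynomial.eval_comp]
  exact Nat.add_le_add_left (eval_mono q (hr x)) _

/-- The description of a pair: that of the first component in letters `inl a`, then that of the
second component in letters `inr b`. -/
def pairEnc (ea : α → List A) (eb : β → List B) (p : α × β) : List (A ⊕ B) :=
  (ea p.1).map .inl ++ (eb p.2).map .inr

theorem PolyTime.pair {g : α → γ} [Finite A] [Finite B] [Finite C] (hf : PolyTime ea eb f)
    (hg : PolyTime ea ec g) : PolyTime ea (pairEnc eb ec) (fun x => (f x, g x)) := by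
  let copy : Program (Triple A A (B ⊕ C)) :=
    .distribute 0 fun x => fun | 0 | 1 => some x | 2 => none
  obtain ⟨P, p, hP⟩ := hg.exists_program (Γ := Triple A A (B ⊕ C)) 1 2 id .inr
  obtain ⟨Q, q, hQ⟩ := hf.exists_program (Γ := Triple A A (B ⊕ C)) 0 2 id .inl
  refine .of_program ((copy.seq P).seq Q) 0 2 (2 * (.X + 1) + p + q) fun x => ?_
  have hcopy :
      copy.Runs (2 * ((ea x).length + 1)) (triple (ea x) [] []) (triple (ea x) (ea x) []) :=
    Program.Runs.distribute (Γ := Triple A A (B ⊕ C)) (a := 0) (S := triple (ea x) [] [])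
      fun r => by fin_cases r <;> simp [triple]
  have hPx := hP x (triple (ea x) (ea x) []) (List.map_id _)
  have hQx := hQ x (triple (ea x) [] ((ec (g x)).map .inr)) (List.map_id _)
  have transfer_one : transfer (triple (ea x) (ea x) []) 1 2 ((ec (g x)).map .inr) =
      triple (ea x) [] ((ec (g x)).map (.inr : C → B ⊕ C)) := by
    funext r; fin_cases r <;> simp [transfer, triple]
  have transfer_zero : transfer (triple (ea x) [] ((ec (g x)).map .inr)) 0 2 ((eb (f x)).map .inl) =
      triple (B := A) [] [] (pairEnc eb ec (f x, g x)) := by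
    funext r; fin_cases r <;> simp [transfer, triple, pairEnc]
  rw [transfer_one] at hPx
  rw [transfer_zero] at hQx
  rw [single_zero_eq_triple, single_two_eq_triple]
  refine ((hcopy.seq hPx).seq hQx).mono (le_of_eq ?_)
  simp only [Polynomial.eval_add, Polynomial.eval_mul, Polynomial.eval_X, Polynomial.eval_one,
    Polynomial.eval_ofNat]

/-- The description of a natural number in unary. -/
def unaryEnc (n : ℕ) : List Unit := List.replicate n ()

theorem Program.Runs.loop_triple {P : Program (Triple A Unit C)} {t n : ℕ} (s : ℕ → List C)
    (hP : ∀ i < n, ∀ l, P.Runs t (triple [] l (s i)) (triple [] l (s (i + 1)))) :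
    (Program.loop 1 P).Runs (n * (t + 1) + 1) (triple [] (unaryEnc n) (s 0))
      (triple [] [] (s n)) := by
  have hbody (i : ℕ) (hi : i < n) : triple (A := A) [] (unaryEnc (n - i)) (s i) 1 ≠ [] ∧
      P.Runs t (update (triple [] (unaryEnc (n - i)) (s i)) 1 (unaryEnc (n - i)).tail)
        (triple [] (unaryEnc (n - (i + 1))) (s (i + 1))) := by
    obtain ⟨k, rfl⟩ : ∃ k, n = i + 1 + k := ⟨n - (i + 1), by omega⟩
    refine ⟨by simp [triple, unaryEnc, Nat.sub_eq_zero_iff_le, hi], ?_⟩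
    convert hP i hi (unaryEnc (i + 1 + k - (i + 1))) using 1
    funext r
    fin_cases r <;> simp [triple, unaryEnc, Nat.sub_sub]
  have := Program.Runs.loop (fun i => triple (A := A) [] (unaryEnc (n - i)) (s i)) hbody
    (by simp [triple, unaryEnc])
  rwa [Nat.sub_zero, Nat.sub_self] at this

theorem PolyTime.iterate {f : α → α} [Finite A] (hf : PolyTime ea ea f) (r : Polynomial ℕ)
    (hr : ∀ n a, ∀ i ≤ n, (ea (f^[i] a)).length ≤ r.eval (n + (ea a).length)) :
    PolyTime (pairEnc unaryEnc ea) ea (fun p : ℕ × α => f^[p.1] p.2) := by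
  let split : Program (Triple (Unit ⊕ A) Unit A) :=
    .distribute 0 fun x => fun | 0 => none | 1 => x.getLeft? | 2 => x.getRight?
  obtain ⟨P, p, hP⟩ := hf.exists_program (Γ := Triple (Unit ⊕ A) Unit A) 2 2 id id
  refine .of_program (split.seq (.loop 1 P)) 0 2 (2 * (.X + 1) + (.X * (p.comp r + 1) + 1))
    fun ⟨n, a⟩ => ?_
  have hsplit : split.Runs (2 * ((pairEnc unaryEnc ea (n, a)).length + 1))
      (triple (pairEnc unaryEnc ea (n, a)) [] []) (triple [] (unaryEnc n) (ea a)) :=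
    Program.Runs.distribute (Γ := Triple (Unit ⊕ A) Unit A) (a := 0)
      (S := triple (pairEnc unaryEnc ea (n, a)) [] [])
      fun r => by fin_cases r <;> simp [triple, pairEnc, List.filterMap_map, Function.comp_def]
  have hloop := Program.Runs.loop_triple (P := P) (t := (p.comp r).eval (n + (ea a).length))
    (n := n) (fun i => ea (f^[i] a)) fun i hi l => by
      convert (hP (f^[i] a) (triple [] l (ea (f^[i] a))) (List.map_id _)).mono ?_ using 1
      · rw [iterate_succ_apply']
        funext r
        fin_cases r <;> simp [transfer, triple]
      · rw [Polynomial.eval_comp]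
        exact eval_mono p (hr n a i hi.le)
  have hlength : (pairEnc unaryEnc ea (n, a)).length = n + (ea a).length := by
    simp [pairEnc, unaryEnc]
  rw [single_zero_eq_triple, single_two_eq_triple]
  refine (hsplit.seq hloop).mono ?_
  rw [hlength]
  simp only [Polynomial.eval_add, Polynomial.eval_mul, Polynomial.eval_X, Polynomial.eval_one,
    Polynomial.eval_ofNat]
  gcongr
  exact Nat.le_add_right _ _

end Functions

end Programs

/-! ### Polynomial time functions -/

/-- A type with a description of its elements by strings over a finite alphabet. Polynomial time
is meant with respect to these descriptions. -/
class Coded (α : Type) where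
  Alph : Type
  [finite : Finite Alph]
  enc : α → List Alph

attribute [instance] Coded.finite

/-- Finite types whose elements are used as letters of strings. This is not an instance of
finiteness because a pair of letters is described as a pair, by a string of two letters. -/
class Letter (α : Type) : Prop where
  [finite : Finite α]

attribute [instance] Letter.finite

instance : Letter Bool where
instance : Letter Unit where
instance {A : Type} [Letter A] : Letter (Option A) where

instance {A : Type} [Letter A] : Coded A := ⟨A, fun a => [a]⟩
instance {A : Type} [Letter A] : Coded (List A) := ⟨A, fun l => l⟩
instance : Coded ℕ := ⟨Unit, unaryEnc⟩
instance {α β : Type} [Coded α] [Coded β] : Coded (α × β) :=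
  ⟨Coded.Alph α ⊕ Coded.Alph β, pairEnc Coded.enc Coded.enc⟩

/-- The length of the description. -/
def size {α : Type} [Coded α] (a : α) : ℕ := (Coded.enc a).length

/-- Polynomial time functions. -/
@[fun_prop]
def Poly {α β : Type} [Coded α] [Coded β] (f : α → β) : Prop :=
  PolyTime (Coded.enc (α := α)) (Coded.enc (α := β)) f

theorem PolyTime.congr {α β β' A B : Type} {ea : α → List A} {eb : β → List B}
    {eb' : β' → List B} {f : α → β} {f' : α → β'} (h : PolyTime ea eb f)
    (hf : ∀ a, eb' (f' a) = eb (f a)) : PolyTime ea eb' f' := by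
  obtain ⟨M⟩ := h
  exact ⟨{ M with outputsFun := fun a => by rw [hf]; exact M.outputsFun a }⟩

section Calculus

variable {α β γ ε A B C : Type} [Coded α] [Coded β] [Coded γ] [Coded ε] [Letter A] [Letter B]
  [Letter C]

@[simp] theorem size_prod (p : α × β) : size p = size p.1 + size p.2 := by
  simp [size, Coded.enc, pairEnc]

@[simp] theorem size_nat (n : ℕ) : size n = n := List.length_replicate

@[simp] theorem size_list (l : List A) : size l = l.length := rfl

@[simp] theorem size_letter (a : A) : size a = 1 := rfl

namespace Poly

theorem exists_size_le {f : α → β} (hf : Poly f) :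
    ∃ p : Polynomial ℕ, ∀ a, size (f a) ≤ p.eval (size a) :=
  PolyTime.exists_length_le hf

@[fun_prop]
theorem comp {g : β → γ} {f : α → β} (hg : Poly g) (hf : Poly f) : Poly (fun a => g (f a)) :=
  PolyTime.comp hg hf

@[fun_prop]
theorem prodMk {f : α → β} {g : α → γ} (hf : Poly f) (hg : Poly g) : Poly (fun a => (f a, g a)) :=
  PolyTime.pair hf hg

theorem of_filterMap {f : α → β} (φ : Coded.Alph α → Option (Coded.Alph β))
    (h : ∀ a, Coded.enc (f a) = (Coded.enc a).filterMap φ) : Poly f :=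
  PolyTime.mealy (fun q _ => q) (fun _ o => o.bind φ) () fun a =>
    (h a).trans (mealy_eq_filterMap (fun _ => φ) fun _ _ => rfl).symm

@[fun_prop]
theorem id : Poly (fun a : α => a) := of_filterMap some fun _ => List.filterMap_some.symm

@[fun_prop]
theorem fst : Poly (Prod.fst : α × β → α) :=
  of_filterMap (Sum.elim some fun _ => none) fun p => by
    simp [Coded.enc, pairEnc, List.filterMap_map, comp_def]

@[fun_prop]
theorem snd : Poly (Prod.snd : α × β → β) :=
  of_filterMap (Sum.elim (fun _ => none) some) fun p => by
    simp [Coded.enc, pairEnc, List.filterMap_map, comp_def]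

@[fun_prop]
theorem append {f g : α → List A} (hf : Poly f) (hg : Poly g) : Poly (fun a => f a ++ g a) := by
  have : Poly (fun p : List A × List A => p.1 ++ p.2) :=
    of_filterMap (Sum.elim some some) fun p => by
      simp [Coded.enc, pairEnc, List.filterMap_map, comp_def]
  exact this.comp (hf.prodMk hg)

theorem optionToList (o : Option A) : Poly (fun _ : α => o.toList) :=
  PolyTime.mealy (fun q _ => q) (fun _ x => x.elim o fun _ => none) () fun a => by
    induction Coded.enc a with
    | nil => rfl
    | cons _ _ ih => exact ih

@[fun_prop]
theorem const (c : β) : Poly (fun _ : α => c) := by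
  have : Letter (Coded.Alph β) := { }
  have const_list (l : List (Coded.Alph β)) : Poly (fun _ : α => l) := by
    induction l with
    | nil => exact optionToList none
    | cons a l ih => exact append (optionToList (some a)) ih
  exact (const_list (Coded.enc c)).congr fun _ => rfl

@[fun_prop]
theorem singleton {f : α → A} (hf : Poly f) : Poly (fun a => [f a]) :=
  comp (g := fun a => [a]) (of_filterMap some fun _ => rfl) hf

@[fun_prop]
theorem cons {f : α → A} {g : α → List A} (hf : Poly f) (hg : Poly g) :
    Poly (fun a => f a :: g a) := append hf.singleton hg

theorem letter (φ : A → B) {f : α → A} (hf : Poly f) : Poly (fun a => φ (f a)) :=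
  comp (g := φ) (of_filterMap (fun a => some (φ a)) fun _ => rfl) hf

theorem letter₂ (φ : A → B → C) {f : α → A} {g : α → B} (hf : Poly f) (hg : Poly g) :
    Poly (fun a => φ (f a) (g a)) := by
  have : Poly (fun p : A × B => φ p.1 p.2) :=
    PolyTime.mealy (Q := Option A) (fun q => Sum.elim some fun _ => q)
      (fun q x => x.bind (Sum.elim (fun _ => none) fun b => q.map (φ · b))) none fun _ => rfl
  exact this.comp (hf.prodMk hg)

@[fun_prop]
theorem and {f g : α → Bool} (hf : Poly f) (hg : Poly g) : Poly (fun a => f a && g a) :=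
  letter₂ _ hf hg

@[fun_prop]
theorem or {f g : α → Bool} (hf : Poly f) (hg : Poly g) : Poly (fun a => f a || g a) :=
  letter₂ _ hf hg

@[fun_prop]
theorem not {f : α → Bool} (hf : Poly f) : Poly (fun a => !f a) := letter _ hf

@[fun_prop]
theorem cond {c : α → Bool} {f g : α → β} (hc : Poly c) (hf : Poly f) (hg : Poly g) :
    Poly (fun a => cond (c a) (f a) (g a)) := by
  let δ (q : Bool) : Coded.Alph (Bool × β × β) → Bool := Sum.elim (fun b : Bool => b) fun _ => q
  let out (q : Bool) : Coded.Alph (Bool × β × β) → Option (Coded.Alph β) :=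
    Sum.elim (fun _ => none)
      (bif q then Sum.elim some fun _ => none else Sum.elim (fun _ => none) some)
  have : Poly (fun p : Bool × β × β => _root_.cond p.1 p.2.1 p.2.2) := by
    refine PolyTime.mealy δ (fun q x => x.bind (out q)) false ?_
    rintro ⟨b, x, y⟩
    refine Eq.trans ?_ (mealy_eq_filterMap (δ := δ) out (q := b) fun a ha => ?_).symm
    · cases b <;> simp [out, Coded.enc, pairEnc, List.filterMap_map, comp_def]
    · obtain ⟨_, _, rfl⟩ := List.mem_map.1 ha
      rfl
  exact this.comp (hc.prodMk (hf.prodMk hg))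

open Classical in
theorem cases {f : A → α → β} {g : α → A} (hg : Poly g) (hf : ∀ x, Poly (f x)) :
    Poly (fun a => f (g a) a) := by
  have := Fintype.ofFinite A
  rcases isEmpty_or_nonempty α with _ | ⟨⟨a₀⟩⟩
  · exact of_filterMap (fun _ => none) isEmptyElim
  have cases_mem (l : List A) : Poly (fun a => if g a ∈ l then f (g a) a else f (g a₀) a) := by
    induction l with
    | nil => simpa using hf (g a₀)
    | cons x l ih =>
      have mem_cons : (fun a => if g a ∈ x :: l then f (g a) a else f (g a₀) a) = fun a =>
          _root_.cond (decide (g a = x)) (f x a) (if g a ∈ l then f (g a) a else f (g a₀) a) := by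
        funext a
        by_cases h : g a = x <;> simp [h]
      rw [mem_cons]
      exact (letter (fun y => decide (y = x)) hg).cond (hf x) ih
  simpa using cases_mem Finset.univ.toList

theorem mealyList {Q : Type} [Finite Q] (δ : Q → A → Q) (out : Q → Option A → Option B) (q₀ : Q)
    {f : α → List A} (hf : Poly f) : Poly (fun a => mealy δ out q₀ (f a)) :=
  comp (g := mealy δ out q₀) (PolyTime.mealy δ out q₀ fun _ => rfl) hf

@[fun_prop]
theorem head? {f : α → List A} (hf : Poly f) : Poly (fun a => (f a).head?) := by
  let out (started : Bool) (x : Option A) : Option (Option A) := bif started then none else some x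
  have mealy_true (l : List A) : mealy (fun _ _ => true) out true l = [] := by
    induction l with
    | nil => rfl
    | cons _ _ ih => exact ih
  refine comp (g := List.head?) (PolyTime.mealy (fun _ _ => true) out false ?_) hf
  rintro (_ | ⟨a, l⟩)
  · rfl
  · exact congrArg (some a :: ·) (mealy_true l).symm

@[fun_prop]
theorem tail {f : α → List A} (hf : Poly f) : Poly (fun a => (f a).tail) := by
  let out (started : Bool) (x : Option A) : Option A := bif started then x else none
  have mealy_true (l : List A) : mealy (fun _ _ => true) out true l = l := by
    induction l with
    | nil => rfl
    | cons a _ ih => exact congrArg (a :: ·) ih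
  refine comp (g := List.tail) (PolyTime.mealy (fun _ _ => true) out false ?_) hf
  rintro (_ | ⟨_, l⟩)
  · rfl
  · exact (mealy_true l).symm

@[fun_prop]
theorem isEmpty {f : α → List A} (hf : Poly f) : Poly (fun a => (f a).isEmpty) :=
  (letter Option.isNone hf.head?).congr fun a => by cases h : f a <;> rfl

@[fun_prop]
theorem filterMap (φ : A → Option B) {f : α → List A} (hf : Poly f) :
    Poly (fun a => (f a).filterMap φ) :=
  comp (g := List.filterMap φ) (of_filterMap φ fun _ => rfl) hf

@[fun_prop]
theorem map (φ : A → B) {f : α → List A} (hf : Poly f) : Poly (fun a => (f a).map φ) := by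
  simpa using filterMap (fun a => some (φ a)) hf

@[fun_prop]
theorem length {f : α → List A} (hf : Poly f) : Poly (fun a => (f a).length) :=
  (map (fun _ => ()) hf).congr fun a => (List.map_const' (l := f a) (b := ())).symm

@[fun_prop]
theorem replicate (b : A) {f : α → ℕ} (hf : Poly f) : Poly (fun a => List.replicate (f a) b) :=
  comp (g := fun n => List.replicate n b)
    (of_filterMap (fun _ => some b) fun n => by simp [Coded.enc, unaryEnc]) hf

@[fun_prop]
theorem add {f g : α → ℕ} (hf : Poly f) (hg : Poly g) : Poly (fun a => f a + g a) := by
  simpa using ((replicate () hf).append (replicate () hg)).length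

@[fun_prop]
theorem pred {f : α → ℕ} (hf : Poly f) : Poly (fun a => f a - 1) := by
  simpa using (replicate () hf).tail.length

@[fun_prop]
theorem isZero {f : α → ℕ} (hf : Poly f) : Poly (fun a => f a == 0) :=
  (replicate () hf).isEmpty.congr fun a => by cases f a <;> rfl

end Poly

end Calculus

section Recursion

variable {α β ε A : Type} [Coded α] [Coded β] [Coded ε] [Letter A]

theorem iterate_natRec_step {α ε : Type} (step : ε → ℕ → α → α) (e : ε) (a : α) (i n : ℕ) :
    (fun p : ε × ℕ × α => (p.1, p.2.1 + 1, step p.1 p.2.1 p.2.2))^[n] (e, i, a) =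
      (e, i + n, Nat.rec a (fun j => step e (i + j)) n) := by
  induction n with
  | zero => rfl
  | succ n ih => rw [iterate_succ_apply', ih, add_assoc]

theorem size_natRec_le {a : α} {step : ℕ → α → α} {c n : ℕ}
    (h : ∀ i < n, ∀ a, size (step i a) ≤ size a + c) :
    size (Nat.rec (motive := fun _ => α) a step n) ≤ size a + n * c := by
  induction n with
  | zero => simp
  | succ n ih =>
    refine (h n n.lt_succ_self _).trans ?_
    rw [add_mul, one_mul, ← add_assoc]
    exact Nat.add_le_add_right (ih fun i hi => h i (hi.trans n.lt_succ_self)) c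

theorem natRec_foldl_step {α A : Type} (f : α → A → α) (l : List A) (a : α) (n : ℕ) :
    Nat.rec (motive := fun _ => List A × α) (l, a)
      (fun _ p => (p.1.tail, p.1.head?.elim p.2 (f p.2))) n = (l.drop n, (l.take n).foldl f a) := by
  induction n with
  | zero => rfl
  | succ n ih =>
    simp only [ih, List.tail_drop, List.head?_drop, List.take_add_one, List.foldl_append]
    cases l[n]? <;> rfl

namespace Poly

theorem iterate {f : α → α} (hf : Poly f) (r : Polynomial ℕ)
    (hr : ∀ n a, ∀ i ≤ n, size (f^[i] a) ≤ r.eval (n + size a)) :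
    Poly (fun p : ℕ × α => f^[p.1] p.2) :=
  PolyTime.iterate hf r hr

theorem natRec {base : ε → α} {step : ε → ℕ → α → α} {n : ε → ℕ} (hb : Poly base)
    (hs : Poly (fun p : ε × ℕ × α => step p.1 p.2.1 p.2.2)) (hn : Poly n) (r : Polynomial ℕ)
    (hr : ∀ e i a, size (step e i a) ≤ size a + r.eval (size e + i)) :
    Poly (fun e => Nat.rec (motive := fun _ => α) (base e) (step e) (n e)) := by
  have hiterate : Poly (fun p : ℕ × ε × ℕ × α =>
      (fun p : ε × ℕ × α => (p.1, p.2.1 + 1, step p.1 p.2.1 p.2.2))^[p.1] p.2) := by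
    refine iterate (by fun_prop) (.X + .X * r) fun n ⟨e, i, a⟩ k hk => ?_
    have hle := size_natRec_le (a := a) (step := fun j => step e (i + j)) (n := k)
      (c := r.eval (n + size (e, i, a))) fun j hj a' =>
        (hr e (i + j) a').trans <| Nat.add_le_add_left (eval_mono r (by simp; omega)) _
    have := Nat.mul_le_mul_right (r.eval (n + size (e, i, a)))
      (show k ≤ n + size (e, i, a) by omega)
    rw [iterate_natRec_step, Polynomial.eval_add, Polynomial.eval_mul, Polynomial.eval_X]
    simp only [size_prod, size_nat] at this hle ⊢
    omega
  have : Poly fun e => ((fun p : ε × ℕ × α =>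
      (p.1, p.2.1 + 1, step p.1 p.2.1 p.2.2))^[n e] (e, 0, base e)).2.2 := by fun_prop
  simpa only [iterate_natRec_step, zero_add] using this

theorem foldl {f : ε → α → A → α} {l : ε → List A} {init : ε → α} (hl : Poly l) (hi : Poly init)
    (hf : ∀ a, Poly (fun p : ε × α => f p.1 p.2 a)) (r : Polynomial ℕ)
    (hr : ∀ e s a, size (f e s a) ≤ size s + r.eval (size e)) :
    Poly (fun e => (l e).foldl (f e) (init e)) := by
  let step (e : ε) (_ : ℕ) (p : List A × α) : List A × α :=
    (p.1.tail, p.1.head?.elim p.2 (f e p.2))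
  have hstep : Poly (fun p : ε × ℕ × List A × α => step p.1 p.2.1 p.2.2) := by
    refine prodMk (by fun_prop) ?_
    refine cases (f := fun o (p : ε × ℕ × List A × α) => o.elim p.2.2.2 (f p.1 p.2.2.2))
      (g := fun p => p.2.2.1.head?) (by fun_prop) ?_
    rintro (_ | a)
    · exact snd.comp (snd.comp snd)
    · exact (hf a).comp (f := fun p : ε × ℕ × List A × α => (p.1, p.2.2.2)) (by fun_prop)
  have size_step_le (e : ε) (i : ℕ) (p : List A × α) :
      size (step e i p) ≤ size p + r.eval (size e + i) := by
    have : r.eval (size e) ≤ r.eval (size e + i) := eval_mono r (Nat.le_add_right _ _)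
    rcases p with ⟨_ | ⟨a, l⟩, s⟩
    · simp [step]
    · have := hr e s a
      simp only [step, List.tail_cons, List.head?_cons, Option.elim_some, size_prod, size_list,
        List.length_cons] at this ⊢
      omega
  have := natRec (base := fun e => (l e, init e)) (n := fun e => (l e).length) (by fun_prop) hstep
    (by fun_prop) r size_step_le
  simpa only [step, natRec_foldl_step, List.take_length] using snd.comp this

@[fun_prop]
theorem reverse {f : α → List A} (hf : Poly f) : Poly (fun a => (f a).reverse) := by
  have : Poly (fun l : List A => l.foldl (fun acc a => a :: acc) []) :=
    foldl (f := fun (_ : List A) acc a => a :: acc) (by fun_prop) (by fun_prop)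
      (fun a => by fun_prop) 1 (fun _ _ _ => by simp)
  simpa [List.foldl_flip_cons_eq_append'] using this.comp hf

@[fun_prop]
theorem drop {n : α → ℕ} {f : α → List A} (hn : Poly n) (hf : Poly f) :
    Poly (fun a => (f a).drop (n a)) := by
  have natRec_tail (l : List A) (n : ℕ) :
      Nat.rec (motive := fun _ => List A) l (fun _ l => l.tail) n = l.drop n := by
    induction n with
    | zero => rfl
    | succ n ih => simp only [ih, List.tail_drop]
  simpa only [natRec_tail] using
    natRec (step := fun _ _ l => l.tail) hf (by fun_prop) hn 0 (fun _ _ _ => by simp)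

theorem getElem? {n : α → ℕ} {f : α → List A} (hn : Poly n) (hf : Poly f) :
    Poly (fun a => (f a)[n a]?) := by
  simpa using (drop hn hf).head?

@[fun_prop]
theorem getD {n : α → ℕ} {f : α → List A} (d : A) (hn : Poly n) (hf : Poly f) :
    Poly (fun a => (f a).getD (n a) d) := by
  simpa [List.getD] using letter (fun o : Option A => o.getD d) (getElem? hn hf)

@[fun_prop]
theorem sub {f g : α → ℕ} (hf : Poly f) (hg : Poly g) : Poly (fun a => f a - g a) := by
  simpa using (drop hg (replicate () hf)).length

theorem decide_eq {f g : α → ℕ} (hf : Poly f) (hg : Poly g) :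
    Poly (fun a => decide (f a = g a)) := by
  have : Poly (fun a => (f a - g a == 0) && (g a - f a == 0)) := by fun_prop
  refine this.congr fun a => congrArg _ ?_
  rw [Bool.eq_iff_iff]
  simp only [decide_eq_true_eq, Bool.and_eq_true, beq_iff_eq]
  omega

theorem decide_lt {f g : α → ℕ} (hf : Poly f) (hg : Poly g) :
    Poly (fun a => decide (f a < g a)) := by
  have : Poly (fun a => !(g a - f a == 0)) := by fun_prop
  refine this.congr fun a => congrArg _ ?_
  rw [Bool.eq_iff_iff]
  simp only [decide_eq_true_eq, Bool.not_eq_true', beq_eq_false_iff_ne]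
  omega

theorem flatMap_range {n : ε → ℕ} {f : ε → ℕ → List A} (hn : Poly n)
    (hf : Poly (fun p : ε × ℕ => f p.1 p.2)) :
    Poly (fun e => (List.range (n e)).flatMap (f e)) := by
  obtain ⟨r, hr⟩ := hf.exists_size_le
  have natRec_append (e : ε) (n : ℕ) :
      Nat.rec (motive := fun _ => List A) [] (fun i l => l ++ f e i) n =
        (List.range n).flatMap (f e) := by
    induction n with
    | zero => rfl
    | succ n ih => simp only [ih, List.range_succ, List.flatMap_append, List.flatMap_singleton]
  have hstep : Poly (fun p : ε × ℕ × List A => p.2.2 ++ f p.1 p.2.1) :=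
    append (by fun_prop) (hf.comp (f := fun p : ε × ℕ × List A => (p.1, p.2.1)) (by fun_prop))
  have := natRec (base := fun _ : ε => ([] : List A)) (step := fun e i l => l ++ f e i)
    (by fun_prop) hstep hn r fun e i l => by simpa using hr (e, i)
  simpa only [natRec_append] using this

@[fun_prop]
theorem mul {f g : α → ℕ} (hf : Poly f) (hg : Poly g) : Poly (fun a => f a * g a) := by
  simpa using (flatMap_range (f := fun a _ => List.replicate (g a) ()) hf
    (replicate () (hg.comp fst))).length

theorem eval (p : Polynomial ℕ) {f : α → ℕ} (hf : Poly f) : Poly (fun a => p.eval (f a)) := by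
  induction p using Polynomial.induction_on with
  | C a => simpa using const a
  | add p q hp hq => simpa using hp.add hq
  | monomial n a ih =>
    simp only [pow_succ, ← mul_assoc, Polynomial.eval_mul (q := Polynomial.X), Polynomial.eval_X]
    exact ih.mul hf

end Poly

end Recursion

namespace Poly

variable {α A : Type} [Coded α] [Letter A]

@[fun_prop]
theorem takeWhile (φ : A → Bool) {f : α → List A} (hf : Poly f) :
    Poly (fun a => (f a).takeWhile φ) := by
  let δ (q : Bool) (a : A) : Bool := q && φ a
  let out (q : Bool) (x : Option A) : Option A := bif q then x.filter φ else none
  have mealy_false (l : List A) : mealy δ out false l = [] := by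
    induction l with
    | nil => rfl
    | cons _ _ ih => exact ih
  have mealy_true (l : List A) : mealy δ out true l = l.takeWhile φ := by
    induction l with
    | nil => rfl
    | cons a l ih =>
      cases h : φ a
      · simp [mealy, show δ true a = false from h, mealy_false, out, h]
      · simp [mealy, show δ true a = true from h, ih, out, h, Option.filter_some_pos]
  simpa only [mealy_true] using hf.mealyList δ out true

@[fun_prop]
theorem dropWhile (φ : A → Bool) {f : α → List A} (hf : Poly f) :
    Poly (fun a => (f a).dropWhile φ) := by
  have : Poly (fun a => (f a).drop ((f a).takeWhile φ).length) := by fun_prop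
  refine this.congr fun a => congrArg _ ?_
  have := List.drop_left (l₁ := (f a).takeWhile φ) (l₂ := (f a).dropWhile φ)
  rw [List.takeWhile_append_dropWhile] at this
  exact this.symm

end Poly

instance : Finite Symbol :=
  Finite.of_injective (β := Fin 5)
    (fun | .tick => 0 | .sep => 1 | .andSym => 2 | .orSym => 3 | .notSym => 4)
    (by rintro (_ | _) (_ | _) <;> simp)

instance : Letter Symbol where

/-- What the evaluation of a circuit does with the next wire number in the description of the
circuit: take it for the width, compare the value of the wire with the next bit expected, or apply
the rest of a gate to the value. -/
inductive ReadMode where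
  | width
  | output
  | unary (f : Bool → Bool)
  | binary (f : Bool → Bool → Bool)

instance : Finite ReadMode :=
  Finite.of_injective (β := Option (Option ((Bool → Bool) ⊕ (Bool → Bool → Bool))))
    (fun
      | .width => none
      | .output => some none
      | .unary f => some (some (.inl f))
      | .binary f => some (some (.inr f)))
    (by rintro (_ | _) (_ | _) <;> simp)

instance : Letter ReadMode where

/-- The data used by the evaluation of a circuit from its description: the values of the wires, the
wire number read up to now, whether the outputs have been as expected up to now, and the outputs
expected from now on. -/
abbrev ReadData := List Bool × ℕ × Bool × List Bool

/-- The state of the evaluation of a circuit from its description. -/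
abbrev ReadState := ReadMode × ReadData

/-- One step of the evaluation of a circuit from its description. -/
def readSymbol : ReadState → Symbol → ReadState
  | (m, v, i, t), .tick => (m, v, i + 1, t)
  | (.width, v, _, t), .sep => (.output, v, 0, t)
  | (.output, v, i, ok, l), .sep =>
    (.output, v, 0, ok && some (v.getD i false) == l.head?, l.tail)
  | (.unary f, v, i, t), .sep => (.output, v ++ [f (v.getD i false)], 0, t)
  | (.binary f, v, i, t), .sep => (.unary (f (v.getD i false)), v, 0, t)
  | (_, d), .andSym => (.binary and, d)
  | (_, d), .orSym => (.binary or, d)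
  | (_, d), .notSym => (.unary not, d)

/-- Evaluate a circuit, given by its description, on the input `w`, and compare the output
with `w`. -/
def checkFixed (c : List Symbol) (w : List Bool) : Bool :=
  let s : ReadState := c.foldl readSymbol (.width, w, 0, true, w)
  s.2.2.2.1 && s.2.2.2.2.isEmpty

theorem poly_readSymbol_mk (m : ReadMode) (a : Symbol) :
    Poly (fun d : ReadData => readSymbol (m, d) a) := by
  have poly_value : Poly (fun d : ReadData => d.1.getD d.2.1 false) := by fun_prop
  have poly_agree : Poly (fun d : ReadData => some (d.1.getD d.2.1 false) == d.2.2.2.head?) :=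
    .letter₂ (fun a b => some a == b) poly_value (by fun_prop)
  rcases a with _ | _ | _ | _ | _
  · change Poly fun d : ReadData => (m, d.1, d.2.1 + 1, d.2.2)
    fun_prop
  · rcases m with _ | _ | f | f
    · change Poly fun d : ReadData => (ReadMode.output, d.1, 0, d.2.2)
      fun_prop
    · change Poly fun d : ReadData => (ReadMode.output, d.1, 0, (d.2.2.1 && _), d.2.2.2.tail)
      fun_prop
    · have poly_values : Poly (fun d : ReadData => d.1 ++ [f (d.1.getD d.2.1 false)]) :=
        .append .fst (.singleton (.letter f poly_value))
      exact .prodMk (.const _) (poly_values.prodMk (.prodMk (.const 0) (.comp .snd .snd)))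
    · have poly_apply := Poly.letter (fun b => ReadMode.unary (f b)) poly_value
      change Poly fun d : ReadData => (ReadMode.unary (f _), d.1, 0, d.2.2)
      fun_prop
  all_goals exact .prodMk (.const _) .id

theorem poly_checkFixed : Poly (fun p : List Symbol × List Bool => checkFixed p.1 p.2) := by
  have poly_readSymbol (a : Symbol) : Poly (fun s => readSymbol s a) :=
    .cases (f := fun m (s : ReadState) => readSymbol (m, s.2) a) .fst fun m =>
      (poly_readSymbol_mk m a).comp .snd
  have size_readSymbol_le (s : ReadState) (a : Symbol) : size (readSymbol s a) ≤ size s + 1 := by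
    rcases s with ⟨_ | _ | _ | _, v, i, ok, l⟩ <;> cases a <;> simp [readSymbol] <;> omega
  have := Poly.foldl (l := fun p : List Symbol × List Bool => p.1)
    (init := fun p => ((.width, p.2, 0, true, p.2) : ReadState)) (f := fun _ => readSymbol)
    (by fun_prop) (by fun_prop) (fun a => (poly_readSymbol a).comp .snd) 1
    fun _ s a => by simpa using size_readSymbol_le s a
  unfold checkFixed
  fun_prop

theorem foldl_readSymbol_replicate_tick (n : ℕ) (m : ReadMode) (v : List Bool) (i : ℕ)
    (t : Bool × List Bool) :
    (List.replicate n Symbol.tick).foldl readSymbol (m, v, i, t) =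
      (m, v, i + n, t) := by
  induction n generalizing i with
  | zero => rfl
  | succ n ih =>
    rw [List.replicate_succ, List.foldl_cons, add_comm n, ← add_assoc]
    exact ih (i + 1)

theorem foldl_readSymbol_encodeNat (n : ℕ) (m : ReadMode) (v : List Bool) (t : Bool × List Bool) :
    (encodeNat n).foldl readSymbol (m, v, 0, t) =
      readSymbol (m, v, n, t) .sep := by
  rw [encodeNat, List.foldl_append, foldl_readSymbol_replicate_tick, zero_add]
  rfl

theorem foldl_readSymbol_gate (g : Gate) (v : List Bool) (t : Bool × List Bool) :
    g.encode.foldl readSymbol (.output, v, 0, t) =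
      (.output, v ++ [g.eval v], 0, t) := by
  cases g <;> simp [Gate.encode, Gate.eval, foldl_readSymbol_encodeNat, readSymbol]

theorem foldl_readSymbol_gates (gs : List Gate) (v : List Bool) (t : Bool × List Bool) :
    (gs.flatMap Gate.encode).foldl readSymbol (.output, v, 0, t) =
      (.output, gs.foldl (fun v g => v ++ [g.eval v]) v, 0, t) := by
  induction gs generalizing v with
  | nil => rfl
  | cons g gs ih =>
    rw [List.flatMap_cons, List.foldl_append, foldl_readSymbol_gate, ih, List.foldl_cons]

theorem foldl_readSymbol_outputs (os : List ℕ) (v : List Bool) (ok : Bool) (l : List Bool) :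
    let s : ReadState := (os.flatMap encodeNat).foldl readSymbol
      (.output, v, 0, ok, l)
    (s.2.2.2.1 && s.2.2.2.2.isEmpty) = (ok && decide (os.map (v.getD · false) = l)) := by
  induction os generalizing ok l with
  | nil => cases l <;> simp
  | cons o os ih =>
    rw [List.flatMap_cons, List.foldl_append, foldl_readSymbol_encodeNat]
    refine (ih _ _).trans ?_
    cases l with
    | nil => simp
    | cons b l =>
      simp only [List.head?_cons, List.tail_cons, List.map_cons, List.cons.injEq, Bool.and_assoc,
        Bool.decide_and]
      rfl

theorem checkFixed_encode (C : Circuit) (w : List Bool) :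
    checkFixed C.encode w = decide (C.outputs.map ((C.wires w).getD · false) = w) := by
  rw [checkFixed, Circuit.encode, List.foldl_append, List.foldl_append, foldl_readSymbol_encodeNat]
  rw [readSymbol, foldl_readSymbol_gates]
  exact foldl_readSymbol_outputs _ _ true w

theorem Circuit.exists_isFixedPt_iff (C : Circuit) (w : List Bool) :
    (∃ v : List.Vector Bool C.width, IsFixedPt C.fn v ∧ v.toList = w) ↔
      C.outputs.map ((C.wires w).getD · false) = w := by
  constructor
  · rintro ⟨v, hv, rfl⟩
    exact congrArg List.Vector.toList hv
  · intro h
    have hw : w.length = C.width := by rw [← h, List.length_map, C.outputs_length]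
    exact ⟨⟨w, hw⟩, Subtype.ext h, rfl⟩

theorem Algorithm.poly_encode (𝒜 : Algorithm) : Poly (fun x => (𝒜.circuit x).encode) :=
  𝒜.polyTime.congr (eb' := fun l : List Symbol => l) fun _ => rfl

theorem Algorithm.poly_width (𝒜 : Algorithm) : Poly (fun x => (𝒜.circuit x).width) := by
  let isTick (a : Symbol) : Bool := a matches .tick
  have length_takeWhile (n : ℕ) (l : List Symbol) :
      ((encodeNat n ++ l).takeWhile isTick).length = n := by
    simp [encodeNat, List.takeWhile_append_of_pos, isTick]
  have : Poly (fun x => ((𝒜.circuit x).encode.takeWhile isTick).length) :=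
    (𝒜.poly_encode.takeWhile isTick).length
  simpa only [Circuit.encode, length_takeWhile] using this

theorem polyTime_encodeUnary_iff {l : List Bool → ℕ} :
    PolyTime (fun x : List Bool => x) encodeUnary l ↔ Poly l := by
  constructor
  · intro h
    have : Poly (fun x => List.replicate (l x) true) := h.congr fun _ => rfl
    simpa using this.length
  · intro h
    exact PolyTime.congr (h.replicate true) fun _ => rfl

open Classical in
theorem polynomiallyDecidable_iff {R : Set (List Bool × List Bool)} :
    PolynomiallyDecidable R ↔ Poly (fun p : List Bool × List Bool => decide (p ∈ R)) := by
  have poly_encodePair : Poly encodePair :=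
    (Poly.fst.map some).append ((Poly.const none).cons (Poly.snd.map some))
  have polyTime_id : PolyTime encodePair (Coded.enc (α := List Bool × List Bool)) fun p => p := by
    let δ (q : Bool) (o : Option Bool) : Bool := q || o.isNone
    let out (q : Bool) (o : Option (Option Bool)) : Option (Bool ⊕ Bool) :=
      o.bind (·.map (bif q then .inr else .inl))
    have mealy_inr (y : List Bool) : mealy δ out true (y.map some) = y.map .inr := by
      induction y with
      | nil => rfl
      | cons b _ ih => exact congrArg (.inr b :: ·) ih
    refine PolyTime.mealy δ out false fun ⟨x, y⟩ => ?_
    change _ = mealy δ out false (x.map some ++ none :: y.map some)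
    induction x with
    | nil => exact (mealy_inr y).symm
    | cons b _ ih => exact congrArg (.inl b :: ·) ih
  exact ⟨fun h => h.comp (eb := encodePair) (f := fun p => p) (poly_encodePair.congr fun _ => rfl),
    fun h => PolyTime.comp h polyTime_id⟩

/-! ### Runs as one-dimensional automata -/

section Automata

open Turing Turing.TM2

/-- The states of the cells of a one-dimensional automaton where each cell sees its neighbours and
cell 0. -/
def automaton {X : Type} (rule : X → X → X → X → X) (init : ℕ → X) : ℕ → ℕ → X
  | 0, i => init i
  | t + 1, i => rule (automaton rule init t 0) (automaton rule init t (i - 1))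
      (automaton rule init t i) (automaton rule init t (i + 1))

theorem map_automaton {X Y : Type} {φ : X → Y} {rule : X → X → X → X → X}
    {rule' : Y → Y → Y → Y → Y}
    (h : ∀ a b c d, φ (rule a b c d) = rule' (φ a) (φ b) (φ c) (φ d)) (init : ℕ → X) (t i : ℕ) :
    φ (automaton rule init t i) = automaton rule' (fun i => φ (init i)) t i := by
  induction t generalizing i with
  | zero => rfl
  | succ t ih => simp only [automaton, h, ih]

section Micro

variable {K : Type} [DecidableEq K] {Γ : K → Type} {Λ σ : Type} (m : Λ → Stmt Γ Λ σ)

/-- Execute a single instruction. -/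
def microStep : Stmt Γ Λ σ × σ × (∀ k, List (Γ k)) → Stmt Γ Λ σ × σ × (∀ k, List (Γ k))
  | (.push k f q, v, S) => (q, v, update S k (f v :: S k))
  | (.peek k f q, v, S) => (q, f v (S k).head?, S)
  | (.pop k f q, v, S) => (q, f v (S k).head?, update S k (S k).tail)
  | (.load f q, v, S) => (q, f v, S)
  | (.branch f q₁ q₂, v, S) => (cond (f v) q₁ q₂, v, S)
  | (.goto f, v, S) => (m (f v), v, S)
  | (.halt, v, S) => (.halt, v, S)

/-- A configuration with the statement to be executed in place of its label. -/
def microCfg (c : Cfg Γ Λ σ) : Stmt Γ Λ σ × σ × (∀ k, List (Γ k)) :=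
  (c.l.elim .halt m, c.var, c.stk)

theorem exists_microStep_stepAux (q : Stmt Γ Λ σ) (v : σ) (S : ∀ k, List (Γ k)) :
    ∃ n ≤ stmtSize q, (microStep m)^[n] (q, v, S) = microCfg m (stepAux q v S) := by
  induction q generalizing v S with
  | push _ _ _ ih | peek _ _ _ ih | pop _ _ _ ih | load _ _ ih =>
    obtain ⟨n, hn, h⟩ := ih _ _
    exact ⟨n + 1, Nat.succ_le_succ hn, h⟩
  | branch f q₁ q₂ ih₁ ih₂ =>
    cases hf : f v
    · obtain ⟨n, hn, h⟩ := ih₂ v S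
      refine ⟨n + 1, by simp only [stmtSize]; omega, ?_⟩
      simpa [iterate_succ_apply, microStep, hf] using h
    · obtain ⟨n, hn, h⟩ := ih₁ v S
      refine ⟨n + 1, by simp only [stmtSize]; omega, ?_⟩
      simpa [iterate_succ_apply, microStep, hf] using h
  | goto f => exact ⟨1, le_rfl, rfl⟩
  | halt => exact ⟨0, Nat.zero_le _, rfl⟩

theorem Steps.exists_microStep {C : ℕ} (hC : ∀ l, stmtSize (m l) ≤ C) {n c c'}
    (h : Steps m n c c') :
    ∃ n' ≤ n * C, (microStep m)^[n'] (microCfg m c) = microCfg m c' := by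
  induction h with
  | refl => exact ⟨0, Nat.zero_le _, rfl⟩
  | @head n l v S c' _ ih =>
    obtain ⟨n₁, hn₁, h₁⟩ := exists_microStep_stepAux m (m l) v S
    obtain ⟨n₂, hn₂, h₂⟩ := ih
    refine ⟨n₂ + n₁, ?_, ?_⟩
    · have := hC l
      rw [add_mul]
      omega
    · rw [iterate_add_apply, ← h₂, ← h₁]
      rfl

theorem Steps.microStep_of_le {C : ℕ} (hC : ∀ l, stmtSize (m l) ≤ C) {n c c'}
    (h : Steps m n c c') (hc' : c'.l = none) {N : ℕ} (hN : n * C ≤ N) :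
    (microStep m)^[N] (microCfg m c) = microCfg m c' := by
  obtain ⟨n', hn', h'⟩ := h.exists_microStep m hC
  obtain ⟨d, rfl⟩ := Nat.exists_eq_add_of_le (hn'.trans hN)
  rw [add_comm, iterate_add_apply, h']
  have : IsFixedPt (microStep m) (microCfg m c') := by
    rcases c' with ⟨l, v, S⟩
    cases hc'
    rfl
  exact this.iterate d

variable (Γ Λ σ) in
/-- The symbols at the same depth in all stacks; those at the top are accompanied by the control
information. -/
abbrev Cell := Option (Stmt Γ Λ σ × σ) × (∀ k, Option (Γ k))

/-- The content of cell number `i`. -/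
def cellOf (c : Stmt Γ Λ σ × σ × (∀ k, List (Γ k))) (i : ℕ) : Cell Γ Λ σ :=
  (if i = 0 then some (c.1, c.2.1) else none, fun k => (c.2.2 k)[i]?)

/-- The initial content of a cell where `k₀` is the only stack that may be nonempty and `o` is what
it contains at the depth of the cell. -/
def startCell (q : Stmt Γ Λ σ) (v : σ) (k₀ : K) (isTop : Bool) (o : Option (Γ k₀)) : Cell Γ Λ σ :=
  (if isTop then some (q, v) else none, fun k => (single k₀ o.toList k).head?)

theorem cellOf_single (q : Stmt Γ Λ σ) (v : σ) (k₀ : K) (l : List (Γ k₀)) (i : ℕ) :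
    cellOf (q, v, single k₀ l) i = startCell q v k₀ (i == 0) l[i]? := by
  refine Prod.ext (by simp [startCell, cellOf]) (funext fun k => ?_)
  rcases eq_or_ne k k₀ with rfl | hk
  · simp only [startCell, cellOf, single, update_self]
    cases l[i]? <;> rfl
  · simp [startCell, cellOf, hk]

/-- The next content of a cell, given the contents of the top cell, of the cell above, of the cell
itself and of the cell below. -/
def cellRule (top above self below : Cell Γ Λ σ) : Cell Γ Λ σ :=
  match top.1 with
  | none => self
  | some (.push k f q, v) =>
    (self.1.map fun _ => (q, v), update self.2 k (self.1.elim (above.2 k) fun _ => some (f v)))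
  | some (.peek k f q, v) => (self.1.map fun _ => (q, f v (top.2 k)), self.2)
  | some (.pop k f q, v) => (self.1.map fun _ => (q, f v (top.2 k)), update self.2 k (below.2 k))
  | some (.load f q, v) => (self.1.map fun _ => (q, f v), self.2)
  | some (.branch f q₁ q₂, v) => (self.1.map fun _ => (cond (f v) q₁ q₂, v), self.2)
  | some (.goto f, v) => (self.1.map fun _ => (m (f v), v), self.2)
  | some (.halt, v) => (self.1.map fun _ => (.halt, v), self.2)

theorem cellOf_microStep (c : Stmt Γ Λ σ × σ × (∀ k, List (Γ k))) (i : ℕ) :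
    cellOf (microStep m c) i =
      cellRule m (cellOf c 0) (cellOf c (i - 1)) (cellOf c i) (cellOf c (i + 1)) := by
  obtain ⟨q, v, S⟩ := c
  have hif (a b : Stmt Γ Λ σ × σ) : (if i = 0 then some a else none) =
      (if i = 0 then some b else none).map fun _ => a := by split_ifs <;> rfl
  cases q <;> simp only [cellOf, microStep, cellRule, if_true, List.head?_eq_getElem?]
  case push k f q =>
    refine Prod.ext (hif _ _) (funext fun k' => ?_)
    by_cases hk : k' = k
    · subst hk
      cases i <;> simp
    · simp [hk]
  case pop k f q =>
    refine Prod.ext (hif _ _) (funext fun k' => ?_)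
    by_cases hk : k' = k
    · subst hk
      simp
    · simp [hk]
  all_goals exact Prod.ext (hif _ _) rfl

theorem cellOf_iterate_microStep (c : Stmt Γ Λ σ × σ × (∀ k, List (Γ k))) (t i : ℕ) :
    cellOf ((microStep m)^[t] c) i = automaton (cellRule m) (cellOf c) t i := by
  induction t generalizing i with
  | zero => rfl
  | succ t ih => simp only [iterate_succ_apply', cellOf_microStep, ih, automaton]

end Micro

section Finiteness

variable {K : Type} {Γ : K → Type} {Λ σ : Type} (m : Λ → Stmt Γ Λ σ)

/-- The statements of a program. -/
def progStmts : Set (Stmt Γ Λ σ) := {q | q = .halt ∨ ∃ l, q ∈ stmts₁ (m l)}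

variable {m} in
theorem mem_progStmts_of_mem_stmts₁ {q q' : Stmt Γ Λ σ} (hq : q ∈ progStmts m) (h : q ≠ .halt)
    (h' : q' ∈ stmts₁ q) : q' ∈ progStmts m := by
  obtain hq | ⟨l, hl⟩ := hq
  · exact absurd hq h
  · exact .inr ⟨l, stmts₁_trans hl h'⟩

variable [DecidableEq K]

/-- The symbols that a program pushes on a stack. -/
def pushed (k : K) : Set (Option (Γ k)) :=
  (fun p : Stmt Γ Λ σ × σ => ((microStep m (p.1, p.2, fun _ => [])).2.2 k).head?) ''
    (progStmts m ×ˢ Set.univ)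

/-- The possible contents of cells. -/
def possibleCells (I : ∀ k, Set (Option (Γ k))) : Set (Cell Γ Λ σ) :=
  (insert none (some '' (progStmts m ×ˢ Set.univ))) ×ˢ {s | ∀ k, s k ∈ pushed m k ∪ I k}

theorem finite_possibleCells [Finite K] [Finite Λ] [Finite σ] {I : ∀ k, Set (Option (Γ k))}
    (hI : ∀ k, (I k).Finite) : (possibleCells m I).Finite := by
  have finite_progStmts : (progStmts m).Finite := by
    have : progStmts m = {.halt} ∪ ⋃ l, ↑(stmts₁ (m l)) := by
      ext q
      simp [progStmts]
    rw [this]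
    exact (Set.finite_singleton _).union (Set.finite_iUnion fun l => Finset.finite_toSet _)
  have finite_control := finite_progStmts.prod (Set.finite_univ (α := σ))
  exact ((finite_control.image _).insert _).prod
    (Set.Finite.pi' fun k => (finite_control.image _).union (hI k))

variable {m}

theorem map_update_mem_possibleCells {I : ∀ k, Set (Option (Γ k))} {c : Cell Γ Λ σ}
    (hc : c ∈ possibleCells m I) {q : Stmt Γ Λ σ} (hq : q ∈ progStmts m) (v : σ) (k : K)
    {o : Option (Γ k)} (ho : o ∈ pushed m k ∪ I k) :
    ((c.1.map fun _ => (q, v)), update c.2 k o) ∈ possibleCells m I := by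
  refine ⟨?_, fun k' => ?_⟩
  · cases c.1
    · exact .inl rfl
    · exact .inr ⟨_, ⟨hq, trivial⟩, rfl⟩
  · rcases eq_or_ne k' k with rfl | hk
    · simpa using ho
    · simpa [hk] using hc.2 k'

theorem cellRule_mem {I : ∀ k, Set (Option (Γ k))} {a b c d : Cell Γ Λ σ}
    (ha : a ∈ possibleCells m I) (hb : b ∈ possibleCells m I) (hc : c ∈ possibleCells m I)
    (hd : d ∈ possibleCells m I) : cellRule m a b c d ∈ possibleCells m I := by
  have map_mem {q : Stmt Γ Λ σ} (hq : q ∈ progStmts m) (v : σ) :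
      ((c.1.map fun _ => (q, v)), c.2) ∈ possibleCells m I := by
    refine ⟨?_, hc.2⟩
    cases c.1
    · exact .inl rfl
    · exact .inr ⟨_, ⟨hq, trivial⟩, rfl⟩
  obtain ⟨ha, -⟩ := ha
  rcases a with ⟨_ | ⟨q, v⟩, s⟩
  · exact hc
  obtain h | ⟨_, ⟨hq, -⟩, h⟩ := ha
  · cases h
  cases h
  have next_mem {q' : Stmt Γ Λ σ} := mem_progStmts_of_mem_stmts₁ (q' := q') hq
  cases q with
  | push k f q =>
    refine map_update_mem_possibleCells hc (next_mem nofun (by simp [stmts₁, stmts₁_self])) v k ?_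
    cases c.1
    · exact hb.2 k
    · exact .inl ⟨(.push k f q, v), ⟨hq, trivial⟩, by simp [microStep]⟩
  | peek k f q | load f q => exact map_mem (next_mem nofun (by simp [stmts₁, stmts₁_self])) _
  | pop k f q =>
    exact map_update_mem_possibleCells hc (next_mem nofun (by simp [stmts₁, stmts₁_self])) _ k
      (hd.2 k)
  | branch f q₁ q₂ =>
    exact map_mem (next_mem nofun (by cases f v <;> simp [stmts₁, stmts₁_self])) _
  | goto f => exact map_mem (.inr ⟨_, stmts₁_self⟩) _
  | halt => exact map_mem (.inl rfl) _

end Finiteness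

theorem PolyTime.exists_automaton {α A : Type} [Finite A] {ea : α → List A} {f : α → Bool}
    (h : PolyTime ea Computability.encodeBool f) :
    ∃ (X : Type) (_ : Finite X) (rule : X → X → X → X → X) (init : Bool → Option A → X)
      (acc : X → Bool) (p : Polynomial ℕ), ∀ a, ∀ N ≥ p.eval (ea a).length,
        acc (automaton rule (fun i => init (i == 0) (ea a)[i]?) N 0) = f a := by
  classical
  obtain ⟨tm, iA, iB, p, h⟩ := polyTime_iff_exists_steps.1 h
  have := tm.kFin
  have := tm.ΛFin
  have := tm.σFin
  obtain ⟨C, hC⟩ := exists_stmtSize_le tm.m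
  let start (isTop : Bool) (o : Option A) : Cell tm.Γ tm.Λ tm.σ :=
    startCell (tm.m tm.main) tm.initialState tm.k₀ isTop (o.map iA.symm)
  let D := possibleCells tm.m fun k => Set.range fun o => (start false o).2 k
  have : Finite D := (finite_possibleCells tm.m fun k => Set.finite_range _).to_subtype
  have start_mem (b : Bool) (o : Option A) : start b o ∈ D := by
    refine ⟨?_, fun k => .inr ⟨o, rfl⟩⟩
    cases b
    · exact .inl rfl
    · exact .inr ⟨_, ⟨.inr ⟨_, stmts₁_self⟩, trivial⟩, rfl⟩
  let rule (a b c d : D) : D := ⟨cellRule tm.m a b c d, cellRule_mem a.2 b.2 c.2 d.2⟩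
  refine ⟨D, this, rule, fun b o => ⟨start b o, start_mem b o⟩,
    fun c => decide (c.1.2 tm.k₁ = some (iB.symm true)), p * .C C, fun a N hN => ?_⟩
  have start_eq_cellOf : (fun i => start (i == 0) (ea a)[i]?) =
      cellOf (microCfg tm.m ⟨some tm.main, tm.initialState,
        single tm.k₀ ((ea a).map iA.symm)⟩) :=
    funext fun i => by rw [microCfg, cellOf_single, List.getElem?_map]; rfl
  obtain ⟨n, hn, hsteps⟩ := h a
  have hrun := hsteps.microStep_of_le tm.m hC rfl (N := N) <| by
    rw [Polynomial.eval_mul, Polynomial.eval_C] at hN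
    exact (Nat.mul_le_mul_right C hn).trans hN
  beta_reduce
  rw [map_automaton (φ := Subtype.val) (rule' := cellRule tm.m) fun _ _ _ _ => rfl,
    start_eq_cellOf, ← cellOf_iterate_microStep, hrun]
  cases f a <;> simp [cellOf, microCfg, Computability.encodeBool]

end Automata

/-! ### Circuits that simulate runs -/

/-- Boolean formulas with variables from `V`. The constructor `copy` does not change the value; it
allows formulas to be padded to a prescribed size. -/
inductive BoolForm (V : Type*) where
  | var (x : V)
  | copy (e : BoolForm V)
  | neg (e : BoolForm V)
  | and (e e' : BoolForm V)
  | or (e e' : BoolForm V)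

namespace BoolForm

variable {V : Type*}

/-- The value of a formula. -/
def eval (a : V → Bool) : BoolForm V → Bool
  | var x => a x
  | copy e => e.eval a
  | neg e => !e.eval a
  | and e e' => e.eval a && e'.eval a
  | or e e' => e.eval a || e'.eval a

/-- The number of gates needed for a formula. -/
def size : BoolForm V → ℕ
  | var _ => 1
  | copy e | neg e => e.size + 1
  | and e e' | or e e' => e.size + e'.size + 1

theorem size_pos (e : BoolForm V) : 0 < e.size := by cases e <;> simp [size]

theorem exists_eval_eq_of_dependsOn [Nonempty V] (s : Finset V) {f : (V → Bool) → Bool}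
    (hf : DependsOn f s) : ∃ e : BoolForm V, ∀ a, e.eval a = f a := by
  classical
  induction s using Finset.induction_on generalizing f with
  | empty =>
    obtain ⟨x₀⟩ := ‹Nonempty V›
    have eq_const (a : V → Bool) : f a = f fun _ => false := hf (by simp)
    cases h : f fun _ => false
    · exact ⟨.and (.var x₀) (.neg (.var x₀)), fun a => by simp [eval, eq_const a, h]⟩
    · exact ⟨.or (.var x₀) (.neg (.var x₀)), fun a => by simp [eval, eq_const a, h]⟩
  | insert x s _ ih =>
    have restriction (c : Bool) : DependsOn (fun a => f (update a x c)) s := fun a b hab =>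
      hf fun y hy => by
        obtain rfl | hyx := eq_or_ne y x
        · simp
        · simpa [hyx] using hab y ((Finset.mem_insert.1 hy).resolve_left hyx)
    obtain ⟨e₀, h₀⟩ := ih (restriction false)
    obtain ⟨e₁, h₁⟩ := ih (restriction true)
    refine ⟨.or (.and (.var x) e₁) (.and (.neg (.var x)) e₀), fun a => ?_⟩
    have ha := update_eq_self x a
    cases hx : a x <;> rw [hx] at ha <;> simp [eval, h₀, h₁, hx, ha]

theorem exists_eval_eq [Finite V] [Nonempty V] (f : (V → Bool) → Bool) :
    ∃ e : BoolForm V, ∀ a, e.eval a = f a := by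
  have := Fintype.ofFinite V
  exact exists_eval_eq_of_dependsOn Finset.univ (by simpa using dependsOn_univ f)

theorem exists_size_eq [Finite V] [Nonempty V] (f : (V → Bool) → Bool) :
    ∃ s, ∀ M ≥ s, ∃ e : BoolForm V, e.size = M ∧ ∀ a, e.eval a = f a := by
  obtain ⟨e, he⟩ := exists_eval_eq f
  refine ⟨e.size, fun M hM => ?_⟩
  induction M, hM using Nat.le_induction with
  | base => exact ⟨e, rfl, he⟩
  | succ M _ ih =>
    obtain ⟨e', hsize, heval⟩ := ih
    exact ⟨e'.copy, by simp [size, hsize], heval⟩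

theorem exists_family_size_eq {ι : Type*} [Finite ι] [Finite V] [Nonempty V]
    (f : ι → (V → Bool) → Bool) :
    ∃ s, ∀ M ≥ s, ∃ e : ι → BoolForm V, ∀ i, (e i).size = M ∧ ∀ a, (e i).eval a = f i a := by
  choose s hs using fun i => exists_size_eq (f i)
  obtain ⟨B, hB⟩ := (Set.finite_range s).bddAbove
  refine ⟨B, fun M hM => ?_⟩
  choose e he using fun i => hs i M ((hB ⟨i, rfl⟩).trans hM)
  exact ⟨e, he⟩

/-- Gates that compute the value of a formula, numbered from `base` on, where variable `x` is the
wire `ρ x`. The value is that of the last gate. -/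
def gates (ρ : V → ℕ) : BoolForm V → ℕ → List Gate
  | var x, _ => [.andGate (ρ x) (ρ x)]
  | copy e, base => e.gates ρ base ++ [.andGate (base + e.size - 1) (base + e.size - 1)]
  | neg e, base => e.gates ρ base ++ [.notGate (base + e.size - 1)]
  | and e e', base => e.gates ρ base ++ (e'.gates ρ (base + e.size) ++
      [.andGate (base + e.size - 1) (base + e.size + e'.size - 1)])
  | or e e', base => e.gates ρ base ++ (e'.gates ρ (base + e.size) ++
      [.orGate (base + e.size - 1) (base + e.size + e'.size - 1)])

@[simp] theorem length_gates (ρ : V → ℕ) (e : BoolForm V) (base : ℕ) :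
    (e.gates ρ base).length = e.size := by
  induction e generalizing base <;> simp_all [gates, size, add_assoc]

end BoolForm

/-- Each gate in a list satisfies `P` together with its number, where numbers start from `base`. -/
def AllAt (P : ℕ → Gate → Prop) : ℕ → List Gate → Prop
  | _, [] => True
  | base, g :: gs => P base g ∧ AllAt P (base + 1) gs

section AllAt

variable {P : ℕ → Gate → Prop} {base : ℕ}

@[simp] theorem allAt_nil : AllAt P base [] := trivial

@[simp] theorem allAt_cons {g : Gate} {gs : List Gate} :
    AllAt P base (g :: gs) ↔ P base g ∧ AllAt P (base + 1) gs := Iff.rfl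

theorem allAt_append {gs gs' : List Gate} :
    AllAt P base (gs ++ gs') ↔ AllAt P base gs ∧ AllAt P (base + gs.length) gs' := by
  induction gs generalizing base with
  | nil => simp
  | cons g gs ih => simp [ih, and_assoc, add_assoc, add_comm 1]

theorem AllAt.get {gs : List Gate} (h : AllAt P base gs) (k : ℕ) (hk : k < gs.length) :
    P (base + k) gs[k] := by
  induction gs generalizing base k with
  | nil => simp at hk
  | cons g gs ih =>
    cases k with
    | zero => exact h.1
    | succ k =>
      have := ih h.2 k (by simpa using hk)
      rwa [add_assoc, add_comm 1] at this

theorem allAt_flatMap {ι : Type*} {l : List ι} {G : ι → List Gate} {len : ℕ}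
    (hG : ∀ i, (G i).length = len) :
    AllAt P base (l.flatMap G) ↔ ∀ k (hk : k < l.length), AllAt P (base + k * len) (G l[k]) := by
  induction l generalizing base with
  | nil => simp
  | cons i l ih =>
    rw [List.flatMap_cons, allAt_append, ih, hG]
    constructor
    · rintro ⟨h, h'⟩ k hk
      cases k with
      | zero => simpa using h
      | succ k =>
        have := h' k (by simpa using hk)
        rwa [add_assoc, add_comm len, ← Nat.succ_mul] at this
    · intro h
      refine ⟨?_, fun k hk => ?_⟩
      · have := h 0 (by simp)
        rwa [Nat.zero_mul, Nat.add_zero, List.getElem_cons_zero] at this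
      · have := h (k + 1) (by simpa using hk)
        rwa [Nat.succ_mul, add_comm (k * len), ← add_assoc] at this

theorem allAt_flatMap_range {n : ℕ} {G : ℕ → List Gate} {len : ℕ} (hG : ∀ i, (G i).length = len) :
    AllAt P base ((List.range n).flatMap G) ↔ ∀ i < n, AllAt P (base + i * len) (G i) := by
  simp [allAt_flatMap hG]

theorem allAt_flatMap_finRange {n : ℕ} {G : Fin n → List Gate} {len : ℕ}
    (hG : ∀ i, (G i).length = len) :
    AllAt P base ((List.finRange n).flatMap G) ↔ ∀ i : Fin n, AllAt P (base + i * len) (G i) := by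
  simp [allAt_flatMap hG, Fin.forall_iff]

end AllAt

/-- The output of a gate, given the values of all wires. -/
def Gate.value (val : ℕ → Bool) : Gate → Bool
  | andGate i j => val i && val j
  | orGate i j => val i || val j
  | notGate i => !val i

/-- Values of wires that are in accordance with the gates. -/
abbrev Computes (val : ℕ → Bool) : ℕ → List Gate → Prop := AllAt fun k g => val k = g.value val

/-- Gates that only read wires with smaller numbers. -/
abbrev Acyclic : ℕ → List Gate → Prop := AllAt fun k g => g.ReadsBelow k

theorem BoolForm.acyclic_gates {V : Type*} {ρ : V → ℕ} (e : BoolForm V) {base : ℕ}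
    (hρ : ∀ x, ρ x < base) : Acyclic base (e.gates ρ base) := by
  induction e generalizing base with
  | var x => exact ⟨⟨hρ x, hρ x⟩, trivial⟩
  | copy e ih | neg e ih =>
    have := e.size_pos
    rw [gates, Acyclic, allAt_append]
    refine ⟨ih hρ, ?_⟩
    simp only [length_gates, allAt_cons, allAt_nil, Gate.ReadsBelow, and_true]
    omega
  | and e e' ih ih' | or e e' ih ih' =>
    have := e.size_pos
    have := e'.size_pos
    rw [gates, Acyclic, allAt_append, allAt_append]
    refine ⟨ih hρ, ?_, ?_⟩
    · simpa using ih' fun x => (hρ x).trans_le (Nat.le_add_right _ _)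
    · simp only [length_gates, allAt_cons, allAt_nil, Gate.ReadsBelow, and_true]
      omega

theorem BoolForm.value_of_computes {V : Type*} {ρ : V → ℕ} (e : BoolForm V) {base : ℕ}
    {val : ℕ → Bool} (h : Computes val base (e.gates ρ base)) :
    val (base + e.size - 1) = e.eval fun x => val (ρ x) := by
  induction e generalizing base with
  | var x => simpa [gates, Gate.value, eval, size] using h
  | copy e ih | neg e ih =>
    rw [gates, Computes, allAt_append] at h
    have h' := h.2
    simp only [length_gates, allAt_cons, Gate.value, ih h.1, Bool.and_self] at h'
    simpa [size, eval, ← add_assoc] using h'.1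
  | and e e' ih ih' | or e e' ih ih' =>
    rw [gates, Computes, allAt_append, allAt_append, length_gates] at h
    have h' := h.2.2
    simp only [length_gates, allAt_cons, Gate.value, ih h.1, ih' h.2.1] at h'
    simpa [size, eval, ← add_assoc] using h'.1

theorem Gate.value_congr {g : Gate} {n : ℕ} (hg : g.ReadsBelow n) {val val' : ℕ → Bool}
    (h : ∀ i < n, val i = val' i) : g.value val = g.value val' := by
  cases g with
  | andGate i j | orGate i j => simp only [value, h i hg.1, h j hg.2]
  | notGate i => simp only [value, h i hg]

theorem prefix_foldl_append_eval (gs : List Gate) (v : List Bool) :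
    v <+: gs.foldl (fun v g => v ++ [g.eval v]) v := by
  induction gs generalizing v with
  | nil => exact List.prefix_rfl
  | cons g gs ih => exact (List.prefix_append v [g.eval v]).trans (ih _)

theorem Acyclic.computes_foldl_append_eval {gs : List Gate} {v : List Bool}
    (h : Acyclic v.length gs) :
    Computes ((gs.foldl (fun v g => v ++ [g.eval v]) v).getD · false) v.length gs := by
  induction gs generalizing v with
  | nil => trivial
  | cons g gs ih =>
    have length_snoc : (v ++ [g.eval v]).length = v.length + 1 := by simp
    have computes_tail := ih (v := v ++ [g.eval v]) (by rw [length_snoc]; exact h.2)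
    rw [length_snoc] at computes_tail
    refine ⟨?_, computes_tail⟩
    obtain ⟨u, hu⟩ := prefix_foldl_append_eval gs (v ++ [g.eval v])
    rw [List.foldl_cons, ← hu, List.append_assoc]
    calc (v ++ ([g.eval v] ++ u)).getD v.length false
      _ = g.eval v := by simp
      _ = g.value (v.getD · false) := by cases g <;> rfl
      _ = _ := Gate.value_congr h.1 fun i hi => (List.getD_append _ _ _ _ hi).symm

section PolyGates

variable {ε : Type} [Coded ε]

@[fun_prop]
theorem Poly.min {f g : ε → ℕ} (hf : Poly f) (hg : Poly g) :
    Poly (fun e => min (f e) (g e)) := by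
  have : Poly (fun e => f e - (f e - g e)) := by fun_prop
  exact this.congr fun e => congrArg _ (by omega)

/-- The descriptions of the gates are computable in polynomial time. -/
def PolyGates (G : ε → List Gate) : Prop := Poly (fun e => (G e).flatMap Gate.encode)

@[fun_prop]
theorem Poly.encodeNat {f : ε → ℕ} (hf : Poly f) : Poly (fun e => encodeNat (f e)) := by
  unfold NCCirc.encodeNat
  fun_prop

theorem PolyGates.nil : PolyGates (fun _ : ε => []) := Poly.const _

theorem PolyGates.append {G H : ε → List Gate} (hG : PolyGates G) (hH : PolyGates H) :
    PolyGates (fun e => G e ++ H e) := by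
  simpa only [PolyGates, List.flatMap_append] using Poly.append hG hH

theorem PolyGates.andGate {f g : ε → ℕ} (hf : Poly f) (hg : Poly g) :
    PolyGates (fun e => [.andGate (f e) (g e)]) := by
  simpa [PolyGates, Gate.encode] using
    (Poly.const (α := ε) Symbol.andSym).cons (hf.encodeNat.append hg.encodeNat)

theorem PolyGates.orGate {f g : ε → ℕ} (hf : Poly f) (hg : Poly g) :
    PolyGates (fun e => [.orGate (f e) (g e)]) := by
  simpa [PolyGates, Gate.encode] using
    (Poly.const (α := ε) Symbol.orSym).cons (hf.encodeNat.append hg.encodeNat)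

theorem PolyGates.notGate {f : ε → ℕ} (hf : Poly f) : PolyGates (fun e => [.notGate (f e)]) := by
  simpa [PolyGates, Gate.encode] using (Poly.const (α := ε) Symbol.notSym).cons hf.encodeNat

theorem PolyGates.form {V : Type*} (e : BoolForm V) {ρ : ε → V → ℕ} {base : ε → ℕ}
    (hρ : ∀ x, Poly (fun a => ρ a x)) (hb : Poly base) :
    PolyGates (fun a => e.gates (ρ a) (base a)) := by
  induction e generalizing base with
  | var x => exact .andGate (hρ x) (hρ x)
  | copy e ih => exact (ih hb).append (.andGate (by fun_prop) (by fun_prop))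
  | neg e ih => exact (ih hb).append (.notGate (by fun_prop))
  | and e e' ih ih' =>
    exact (ih hb).append ((ih' (by fun_prop)).append (.andGate (by fun_prop) (by fun_prop)))
  | or e e' ih ih' =>
    exact (ih hb).append ((ih' (by fun_prop)).append (.orGate (by fun_prop) (by fun_prop)))

theorem PolyGates.cases {A : Type} [Letter A] {G : A → ε → List Gate} {g : ε → A} (hg : Poly g)
    (hG : ∀ x, PolyGates (G x)) : PolyGates (fun e => G (g e) e) :=
  Poly.cases (f := fun x e => (G x e).flatMap Gate.encode) hg hG

theorem PolyGates.flatMap_list {ι : Type*} (l : List ι) {G : ε → ι → List Gate}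
    (hG : ∀ i, PolyGates (fun e => G e i)) : PolyGates (fun e => l.flatMap (G e)) := by
  induction l with
  | nil => exact .nil
  | cons i l ih => exact (hG i).append ih

theorem PolyGates.flatMap_range {n : ε → ℕ} {G : ε → ℕ → List Gate} (hn : Poly n)
    (hG : PolyGates (fun p : ε × ℕ => G p.1 p.2)) :
    PolyGates (fun e => (List.range (n e)).flatMap (G e)) := by
  simpa only [PolyGates, List.flatMap_assoc] using
    Poly.flatMap_range (f := fun e i => (G e i).flatMap Gate.encode) hn hG

end PolyGates

/-- Where the letter in a cell of the initial configuration comes from: `none` for no letter,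
`some none` for a bit of the input of the circuit, `some (some o)` for the letter `o`. -/
abbrev Source := Option (Option (Option Bool))

/-- The letter, given the bit of the input. -/
def Source.letter (k : Source) (u : Bool) : Option (Option Bool) := k.map fun o => o.getD (some u)

/-- The source of letter number `i` of `encodePair (x, y)`, where `y` has length `n`. -/
def source (x : List Bool) (n i : ℕ) : Source :=
  (x.map some ++ [none])[i]?.elim (cond (decide (i < x.length + 1 + n)) (some none) none)
    fun o => some (some o)

/-- The input wire with letter number `i` of `encodePair (x, y)`, where `y` is the input of length
`n`. Cells that hold no bit of `y` are given some other input wire. -/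
def inputWire (x : List Bool) (n i : ℕ) : ℕ := min (i - (x.length + 1)) (n - 1)

theorem inputWire_lt (x : List Bool) {n : ℕ} (hn : 0 < n) (i : ℕ) : inputWire x n i < n := by
  rw [inputWire]
  omega

theorem letter_source (x y : List Bool) (i : ℕ) :
    (source x y.length i).letter (y.getD (inputWire x y.length i) false) =
      (encodePair (x, y))[i]? := by
  have encodePair_eq : encodePair (x, y) = (x.map some ++ [none]) ++ y.map some := by
    simp [encodePair]
  have length_left : (x.map some ++ [none]).length = x.length + 1 := by simp
  rw [encodePair_eq, source, inputWire]
  generalize x.map some ++ [none] = l at length_left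
  rcases lt_or_ge i (x.length + 1) with hi | hi
  · rw [List.getElem?_append_left (by rwa [length_left]),
      List.getElem?_eq_getElem (by rwa [length_left])]
    rfl
  · rw [List.getElem?_append_right (by rwa [length_left]),
      List.getElem?_eq_none (by rwa [length_left]), length_left]
    rcases lt_or_ge i (x.length + 1 + y.length) with hi' | hi'
    · have : i - (x.length + 1) < y.length := by omega
      rw [min_eq_left (by omega)]
      simp [Source.letter, hi', this]
    · rw [List.getElem?_eq_none (by rw [List.length_map]; omega)]
      simp [Source.letter, decide_eq_false hi'.not_gt]

/-- Formulas for simulating an automaton whose states are described by `bits` bits. The formulas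
for the bits all have the same size, so that wire numbers are given by simple arithmetic. -/
structure Simulator where
  bits : ℕ
  formulaSize : ℕ
  step : Fin bits → BoolForm (Fin 4 × Fin bits)
  start : Bool → Source → Fin bits → BoolForm Unit
  final : BoolForm (Option (Fin bits))
  size_step : ∀ j, (step j).size = formulaSize
  size_start : ∀ c k j, (start c k j).size = formulaSize

namespace Simulator

variable (τ : Simulator)

/-- The number of gates for a cell. -/
def cellSize : ℕ := τ.bits * τ.formulaSize

/-- The number of gates for a step of `S` cells. -/
def rowSize (S : ℕ) : ℕ := S * τ.cellSize

/-- The first gate of the configuration of `S` cells after `t` steps, in a circuit of width `n`. -/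
def rowBase (n S t : ℕ) : ℕ := n + t * τ.rowSize S

/-- The first gate of cell `i` after `t` steps. -/
def cellBase (n S t i : ℕ) : ℕ := τ.rowBase n S t + i * τ.cellSize

/-- The first gate of bit `j` of cell `i` after `t` steps. -/
def bitBase (n S t i : ℕ) (j : Fin τ.bits) : ℕ := τ.cellBase n S t i + j * τ.formulaSize

/-- The wire of bit `j` of cell `i` after `t` steps: the one leaving the last gate for that bit. -/
def bitWire (n S t i : ℕ) (j : Fin τ.bits) : ℕ := τ.bitBase n S t i j + τ.formulaSize - 1

/-- Gates for the bits of a cell. -/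
def cellGates {V : Type*} (e : Fin τ.bits → BoolForm V) (ρ : V → ℕ) (base : ℕ) : List Gate :=
  (List.finRange τ.bits).flatMap fun j => (e j).gates ρ (base + j * τ.formulaSize)

/-- Gates for the initial configuration. -/
def startGates (x : List Bool) (n S : ℕ) : List Gate :=
  (List.range S).flatMap fun i => τ.cellGates (τ.start (i == 0) (source x n i))
    (fun _ => inputWire x n i) (τ.cellBase n S 0 i)

/-- The cells seen by cell `i` among `S` cells. The last cell sees itself in place of the cell
after it. -/
def visibleCell (S i : ℕ) : Fin 4 → ℕ := ![0, i - 1, i, min (i + 1) (S - 1)]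

/-- The wire that is read as variable `v` by the formulas for cell `i` after `t + 1` steps. -/
def visibleWire (n S t i : ℕ) (v : Fin 4 × Fin τ.bits) : ℕ :=
  τ.bitWire n S t (visibleCell S i v.1) v.2

/-- Gates for `T` steps. -/
def stepGates (n S T : ℕ) : List Gate :=
  (List.range T).flatMap fun t => (List.range S).flatMap fun i =>
    τ.cellGates τ.step (τ.visibleWire n S t i) (τ.cellBase n S (t + 1) i)

/-- The wire that is read as a variable by the final formula: the first input wire or a bit of
cell 0 after `T` steps. -/
def finalInput (n T : ℕ) (v : Option (Fin τ.bits)) : ℕ := v.elim 0 (τ.bitWire n (T + 1) T 0)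

/-- Gates for simulating `T` steps on `T + 1` cells and computing the final formula. -/
def gates (x : List Bool) (n T : ℕ) : List Gate :=
  τ.startGates x n (T + 1) ++ (τ.stepGates n (T + 1) T ++
    τ.final.gates (τ.finalInput n T) (τ.rowBase n (T + 1) (T + 1)))

/-- The wire with the value of the final formula. -/
def finalWire (n T : ℕ) : ℕ := τ.rowBase n (T + 1) (T + 1) + τ.final.size - 1

variable {τ}

section Layout

variable {V : Type*} {e : Fin τ.bits → BoolForm V} {x : List Bool} {n S T : ℕ}

theorem length_cellGates (he : ∀ j, (e j).size = τ.formulaSize) (ρ : V → ℕ) (base : ℕ) :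
    (τ.cellGates e ρ base).length = τ.cellSize := by
  simp [cellGates, he, cellSize]

theorem length_startGates : (τ.startGates x n S).length = τ.rowSize S := by
  simp [startGates, length_cellGates (τ.size_start _ _), rowSize]

theorem length_stepGates : (τ.stepGates n S T).length = T * τ.rowSize S := by
  simp [stepGates, length_cellGates τ.size_step, rowSize]

theorem length_gates :
    (τ.gates x n T).length = (T + 1) * τ.rowSize (T + 1) + τ.final.size := by
  simp only [gates, List.length_append, length_startGates, length_stepGates,
    BoolForm.length_gates]
  ring

variable {P : ℕ → Gate → Prop}

theorem allAt_cellGates (he : ∀ j, (e j).size = τ.formulaSize) {ρ : V → ℕ} {base : ℕ} :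
    AllAt P base (τ.cellGates e ρ base) ↔ ∀ j : Fin τ.bits,
      AllAt P (base + j * τ.formulaSize) ((e j).gates ρ (base + j * τ.formulaSize)) :=
  allAt_flatMap_finRange fun j => (BoolForm.length_gates _ _ _).trans (he j)

theorem allAt_startGates :
    AllAt P (τ.rowBase n S 0) (τ.startGates x n S) ↔ ∀ i < S, ∀ j : Fin τ.bits,
      AllAt P (τ.bitBase n S 0 i j) ((τ.start (i == 0) (source x n i) j).gates
        (fun _ => inputWire x n i) (τ.bitBase n S 0 i j)) := by
  rw [startGates, allAt_flatMap_range fun i => length_cellGates (τ.size_start _ _) _ _]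
  exact forall₂_congr fun i _ => allAt_cellGates (τ.size_start _ _)

theorem allAt_stepGates :
    AllAt P (τ.rowBase n S 1) (τ.stepGates n S T) ↔ ∀ t < T, ∀ i < S, ∀ j : Fin τ.bits,
      AllAt P (τ.bitBase n S (t + 1) i j) ((τ.step j).gates (τ.visibleWire n S t i)
        (τ.bitBase n S (t + 1) i j)) := by
  have rowBase_one_add (t : ℕ) :
      τ.rowBase n S 1 + t * τ.rowSize S = τ.rowBase n S (t + 1) := by
    simp only [rowBase]
    ring
  rw [stepGates, allAt_flatMap_range (len := τ.rowSize S) fun t => by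
    simp [length_cellGates τ.size_step, rowSize]]
  refine forall₂_congr fun t _ => ?_
  rw [rowBase_one_add, allAt_flatMap_range fun i => length_cellGates τ.size_step _ _]
  exact forall₂_congr fun i _ => allAt_cellGates τ.size_step

theorem allAt_gates :
    AllAt P n (τ.gates x n T) ↔ AllAt P (τ.rowBase n (T + 1) 0) (τ.startGates x n (T + 1)) ∧
      AllAt P (τ.rowBase n (T + 1) 1) (τ.stepGates n (T + 1) T) ∧
      AllAt P (τ.rowBase n (T + 1) (T + 1))
        (τ.final.gates (τ.finalInput n T) (τ.rowBase n (T + 1) (T + 1))) := by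
  rw [gates, allAt_append, allAt_append, length_startGates, length_stepGates]
  simp only [rowBase, zero_mul, one_mul, add_zero, add_assoc, add_comm (τ.rowSize _),
    add_one_mul T]

theorem bitWire_lt {t i : ℕ} (hi : i < S) (j : Fin τ.bits) :
    τ.bitWire n S t i j < τ.rowBase n S (t + 1) := by
  have size_pos : 0 < τ.formulaSize := τ.size_step j ▸ (τ.step j).size_pos
  have cell_le : (i + 1) * τ.cellSize ≤ τ.rowSize S := Nat.mul_le_mul_right _ hi
  have bit_le : (j.1 + 1) * τ.formulaSize ≤ τ.cellSize := Nat.mul_le_mul_right _ j.2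
  rw [add_one_mul] at cell_le bit_le
  rw [bitWire, bitBase, cellBase, rowBase, rowBase, add_one_mul]
  omega

theorem visibleCell_lt {i : ℕ} (hi : i < S) (s : Fin 4) : visibleCell S i s < S := by
  fin_cases s <;> simp only [visibleCell, Fin.reduceFinMk, Matrix.cons_val] <;> omega

theorem acyclic_gates (hn : 0 < n) : Acyclic n (τ.gates x n T) := by
  have le_bitBase (S t i : ℕ) (j : Fin τ.bits) : τ.rowBase n S t ≤ τ.bitBase n S t i j := by
    rw [bitBase, cellBase]
    omega
  refine allAt_gates.2 ⟨allAt_startGates.2 fun i _ j => ?_,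
    allAt_stepGates.2 fun t _ i hi j => ?_, BoolForm.acyclic_gates _ fun v => ?_⟩
  · exact BoolForm.acyclic_gates _ fun _ =>
      (inputWire_lt x hn i).trans_le ((Nat.le_add_right _ _).trans (le_bitBase _ 0 i j))
  · exact BoolForm.acyclic_gates _ fun v =>
      (bitWire_lt (visibleCell_lt hi v.1) v.2).trans_le (le_bitBase _ _ i j)
  · cases v with
    | none => exact hn.trans_le (Nat.le_add_right _ _)
    | some j => exact bitWire_lt (Nat.succ_pos T) j

end Layout

variable (τ) in
/-- The circuit that maps `w` to itself if the final formula yields the first bit of `w`, and that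
changes the first bit otherwise. -/
def circuit (x : List Bool) (n T : ℕ) : Circuit :=
  if hn : 0 < n then
    { width := n
      gates := τ.gates x n T
      outputs := τ.finalWire n T :: (List.range (n - 1)).map (· + 1)
      outputs_length := by
        rw [List.length_cons, List.length_map, List.length_range, Nat.sub_add_cancel hn]
      gates_wf := (acyclic_gates hn).get
      outputs_wf := by
        have := τ.final.size_pos
        simp only [List.mem_cons, List.mem_map, List.mem_range, forall_eq_or_imp, length_gates,
          finalWire, rowBase]
        refine ⟨by omega, ?_⟩
        rintro _ ⟨i, hi, rfl⟩
        omega }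
  else ⟨0, [], [], rfl, by simp, by simp⟩

theorem width_circuit (x : List Bool) (n T : ℕ) : (τ.circuit x n T).width = n := by
  rcases n.eq_zero_or_pos with rfl | hn
  · rfl
  · simp only [circuit, hn, dif_pos]

theorem encode_circuit (x : List Bool) (n T : ℕ) :
    (τ.circuit x n T).encode = cond (n == 0) [.sep] (encodeNat n ++
      ((τ.gates x n T).flatMap Gate.encode ++ (encodeNat (τ.finalWire n T) ++
        (List.range (n - 1)).flatMap fun i => encodeNat (i + 1)))) := by
  rcases n.eq_zero_or_pos with rfl | hn
  · rfl
  · have : (n == 0) = false := beq_false_of_ne hn.ne'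
    simp [circuit, hn, Circuit.encode, this, List.flatMap_map]

section PolyTime

variable {ε : Type} [Coded ε] {x : ε → List Bool} {n S t i T : ε → ℕ}

theorem poly_source (hx : Poly x) (hn : Poly n) (hi : Poly i) :
    Poly (fun e => source (x e) (n e) (i e)) := by
  have poly_letter : Poly (fun e => ((x e).map some ++ [none])[i e]?) :=
    .getElem? hi ((hx.map some).append (.const _))
  have poly_lt : Poly (fun e => decide (i e < (x e).length + 1 + n e)) :=
    .decide_lt hi (by fun_prop)
  exact .letter₂ (fun (o : Option (Option Bool)) c => o.elim (cond c (some none) none)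
    fun o => some (some o)) poly_letter poly_lt

theorem poly_rowBase (hn : Poly n) (hS : Poly S) (ht : Poly t) :
    Poly (fun e => τ.rowBase (n e) (S e) (t e)) := by
  unfold rowBase rowSize
  fun_prop

theorem poly_cellBase (hn : Poly n) (hS : Poly S) (ht : Poly t) (hi : Poly i) :
    Poly (fun e => τ.cellBase (n e) (S e) (t e) (i e)) :=
  (poly_rowBase hn hS ht).add (hi.mul (.const _))

theorem poly_bitWire (hn : Poly n) (hS : Poly S) (ht : Poly t) (hi : Poly i) (j : Fin τ.bits) :
    Poly (fun e => τ.bitWire (n e) (S e) (t e) (i e) j) := by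
  have := poly_cellBase (τ := τ) hn hS ht hi
  unfold bitWire bitBase
  fun_prop

theorem poly_visibleCell (hS : Poly S) (hi : Poly i) (s : Fin 4) :
    Poly (fun e => visibleCell (S e) (i e) s) := by
  fin_cases s
  · exact .const 0
  · exact hi.pred
  · exact hi
  · exact .min (by fun_prop) (by fun_prop)

theorem polyGates_cellGates {V : Type*} (e : Fin τ.bits → BoolForm V) {ρ : ε → V → ℕ}
    {base : ε → ℕ} (hρ : ∀ v, Poly (fun a => ρ a v)) (hb : Poly base) :
    PolyGates (fun a => τ.cellGates e (ρ a) (base a)) :=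
  .flatMap_list _ fun j => .form (e j) hρ (by fun_prop)

theorem polyGates_startGates (hx : Poly x) (hn : Poly n) (hS : Poly S) :
    PolyGates (fun e => τ.startGates (x e) (n e) (S e)) := by
  refine .flatMap_range hS ?_
  have poly_inputWire : Poly (fun p : ε × ℕ => inputWire (x p.1) (n p.1) p.2) := by
    unfold inputWire
    fun_prop
  have polyGates_cell (c : Bool) (k : Source) : PolyGates (fun p : ε × ℕ =>
      τ.cellGates (τ.start c k) (fun _ => inputWire (x p.1) (n p.1) p.2)
        (τ.cellBase (n p.1) (S p.1) 0 p.2)) :=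
    polyGates_cellGates _ (fun _ => poly_inputWire)
      (poly_cellBase (by fun_prop) (by fun_prop) (.const 0) Poly.snd)
  have polyGates_source (c : Bool) :=
    PolyGates.cases (poly_source (hx.comp Poly.fst) (hn.comp Poly.fst) Poly.snd)
      (polyGates_cell c)
  exact PolyGates.cases (Poly.isZero Poly.snd) polyGates_source

theorem polyGates_stepGates (hn : Poly n) (hS : Poly S) (hT : Poly T) :
    PolyGates (fun e => τ.stepGates (n e) (S e) (T e)) := by
  refine .flatMap_range hT ?_
  refine .flatMap_range (G := fun (p : ε × ℕ) i => τ.cellGates τ.step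
    (τ.visibleWire (n p.1) (S p.1) p.2 i) (τ.cellBase (n p.1) (S p.1) (p.2 + 1) i))
    (hS.comp Poly.fst) ?_
  have hn' : Poly (fun p : (ε × ℕ) × ℕ => n p.1.1) := by fun_prop
  have hS' : Poly (fun p : (ε × ℕ) × ℕ => S p.1.1) := by fun_prop
  have ht' : Poly (fun p : (ε × ℕ) × ℕ => p.1.2) := by fun_prop
  exact polyGates_cellGates _
    (fun v => poly_bitWire hn' hS' ht' (poly_visibleCell hS' Poly.snd v.1) v.2)
    (poly_cellBase hn' hS' (by fun_prop) Poly.snd)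

theorem polyGates_gates (hx : Poly x) (hn : Poly n) (hT : Poly T) :
    PolyGates (fun e => τ.gates (x e) (n e) (T e)) := by
  have hS : Poly (fun e => T e + 1) := by fun_prop
  refine (polyGates_startGates hx hn hS).append ((polyGates_stepGates hn hS hT).append
    (.form _ (fun v => ?_) (poly_rowBase hn hS hS)))
  cases v with
  | none => exact .const 0
  | some j => exact poly_bitWire hn hS hT (.const 0) j

theorem poly_encode_circuit (hx : Poly x) (hn : Poly n) (hT : Poly T) :
    Poly (fun e => (τ.circuit (x e) (n e) (T e)).encode) := by
  have poly_gates := polyGates_gates (τ := τ) hx hn hT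
  have poly_finalWire : Poly (fun e => τ.finalWire (n e) (T e)) := by
    have hS : Poly (fun e => T e + 1) := by fun_prop
    have := poly_rowBase (τ := τ) hn hS hS
    unfold finalWire
    fun_prop
  have poly_outputs : Poly (fun e => (List.range (n e - 1)).flatMap fun i => encodeNat (i + 1)) :=
    .flatMap_range (f := fun _ i => encodeNat (i + 1)) (by fun_prop) (by fun_prop)
  simp only [encode_circuit]
  exact .cond hn.isZero (.const _) (hn.encodeNat.append
    (.append poly_gates (poly_finalWire.encodeNat.append poly_outputs)))

end PolyTime

/-- The formulas of `τ` describe an automaton whose states are written by `enc` as bit strings. The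
final formula yields its first variable in accepting states and the negation of that variable
otherwise. -/
structure Simulates {X : Type} (τ : Simulator) (enc : X → Fin τ.bits → Bool)
    (rule : X → X → X → X → X) (init : Bool → Option (Option Bool) → X) (acc : X → Bool) :
    Prop where
  start : ∀ c k j a, (τ.start c k j).eval a = enc (init c (k.letter (a ()))) j
  step : ∀ j (s : Fin 4 → X),
    (τ.step j).eval (fun v => enc (s v.1) v.2) = enc (rule (s 0) (s 1) (s 2) (s 3)) j
  final : ∀ u s, τ.final.eval (Option.elim · u (enc s)) = cond (acc s) u !u

section Simulates

variable {X : Type} {rule : X → X → X → X → X} {init : Bool → Option (Option Bool) → X}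
  {acc : X → Bool}

theorem exists_simulates [Finite X] : ∃ (τ : Simulator) (enc : X → Fin τ.bits → Bool),
    τ.Simulates enc rule init acc := by
  classical
  have : Nonempty X := ⟨init false none⟩
  obtain ⟨b, ⟨φ⟩⟩ := Finite.exists_equiv_fin X
  have : Nonempty (Fin b) := this.map φ
  let enc (s : X) (j : Fin b) : Bool := decide (φ s = j)
  have enc_injective : Injective enc := fun s s' h => by simpa [enc] using congrFun h (φ s')
  have invFun_enc (s : X) : invFun enc (fun j => enc s j) = s :=
    leftInverse_invFun enc_injective s
  let decode (a : Fin 4 × Fin b → Bool) (i : Fin 4) : X := invFun enc fun j => a (i, j)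
  obtain ⟨m₁, exists_step⟩ := BoolForm.exists_family_size_eq fun (j : Fin b) a =>
    enc (rule (decode a 0) (decode a 1) (decode a 2) (decode a 3)) j
  obtain ⟨m₂, exists_start⟩ := BoolForm.exists_family_size_eq (V := Unit)
    fun (i : Bool × Source × Fin b) a => enc (init i.1 (i.2.1.letter (a ()))) i.2.2
  obtain ⟨step, hstep⟩ := exists_step (max m₁ m₂) (le_max_left _ _)
  obtain ⟨start, hstart⟩ := exists_start (max m₁ m₂) (le_max_right _ _)
  obtain ⟨final, hfinal⟩ := BoolForm.exists_eval_eq (V := Option (Fin b)) fun a =>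
    cond (acc (invFun enc fun j => a (some j))) (a none) !a none
  exact ⟨⟨b, max m₁ m₂, step, fun c k j => start (c, k, j), final, fun j => (hstep j).1,
    fun c k j => (hstart (c, k, j)).1⟩, enc,
    { start := fun c k j => (hstart (c, k, j)).2
      step := fun j s => by simp only [(hstep j).2, decode, invFun_enc]
      final := fun u s => by simp only [hfinal, Option.elim, invFun_enc] }⟩

/-- The run of an automaton on the string for a pair. -/
def pairRun (rule : X → X → X → X → X) (init : Bool → Option (Option Bool) → X)
    (x y : List Bool) : ℕ → ℕ → X :=
  automaton rule fun i => init (i == 0) (encodePair (x, y))[i]?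

variable {enc : X → Fin τ.bits → Bool} {x y : List Bool} {T : ℕ} {val : ℕ → Bool}

theorem pairRun_succ (t i : ℕ) : pairRun rule init x y (t + 1) i =
    rule (pairRun rule init x y t 0) (pairRun rule init x y t (i - 1))
      (pairRun rule init x y t i) (pairRun rule init x y t (i + 1)) := rfl

-- The missing cell after the last one corrupts one more cell in each step, whence `i + t ≤ T`.
theorem Simulates.val_bitWire (h : τ.Simulates enc rule init acc) (hy : 0 < y.length)
    (hval : ∀ i < y.length, val i = y.getD i false)
    (hc : Computes val y.length (τ.gates x y.length T)) {t i : ℕ} (hit : i + t ≤ T)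
    (j : Fin τ.bits) :
    val (τ.bitWire y.length (T + 1) t i j) = enc (pairRun rule init x y t i) j := by
  obtain ⟨hstart, hsteps, -⟩ := allAt_gates.1 hc
  induction t generalizing i j with
  | zero =>
    have value := BoolForm.value_of_computes _ (allAt_startGates.1 hstart i (by omega) j)
    rwa [τ.size_start, h.start, hval _ (inputWire_lt x hy i), letter_source] at value
  | succ t ih =>
    have value := BoolForm.value_of_computes _
      (allAt_stepGates.1 hsteps t (by omega) i (by omega) j)
    have visibleCell_eq : visibleCell (T + 1) i = ![0, i - 1, i, i + 1] := by
      rw [visibleCell, min_eq_left (by omega)]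
    have visible (v : Fin 4 × Fin τ.bits) : val (τ.visibleWire y.length (T + 1) t i v) =
        enc (pairRun rule init x y t (visibleCell (T + 1) i v.1)) v.2 := by
      refine ih ?_ v.2
      generalize v.1 = s
      rw [visibleCell_eq]
      fin_cases s <;> simp only [Fin.reduceFinMk, Matrix.cons_val] <;> omega
    simp only [visible, τ.size_step] at value
    rw [h.step _ fun s => pairRun rule init x y t (visibleCell (T + 1) i s),
      visibleCell_eq] at value
    rwa [pairRun_succ]

theorem Simulates.val_finalWire (h : τ.Simulates enc rule init acc) (hy : 0 < y.length)
    (hval : ∀ i < y.length, val i = y.getD i false)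
    (hc : Computes val y.length (τ.gates x y.length T)) :
    val (τ.finalWire y.length T) =
      cond (acc (pairRun rule init x y T 0)) (y.getD 0 false) !y.getD 0 false := by
  have finalInput_eq : (fun v => val (τ.finalInput y.length T v)) =
      (Option.elim · (y.getD 0 false) (enc (pairRun rule init x y T 0))) := by
    funext v
    cases v with
    | none => exact hval 0 hy
    | some j => exact h.val_bitWire hy hval hc (by omega) j
  rw [finalWire, BoolForm.value_of_computes _ (allAt_gates.1 hc).2.2, finalInput_eq, h.final]

theorem Simulates.outputs_eq_iff (h : τ.Simulates enc rule init acc) (hy : 0 < y.length) :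
    (τ.circuit x y.length T).outputs.map
      (((τ.circuit x y.length T).wires y).getD · false) = y ↔
      acc (pairRun rule init x y T 0) = true := by
  have acyclic := acyclic_gates (τ := τ) (x := x) (T := T) hy
  obtain ⟨u, hu⟩ := prefix_foldl_append_eval (τ.gates x y.length T) y
  have computes := acyclic.computes_foldl_append_eval
  simp only [circuit, hy, dif_pos, Circuit.wires]
  generalize (τ.gates x y.length T).foldl (fun v g => v ++ [g.eval v]) y = W at hu computes
  have getD_eq (i : ℕ) (hi : i < y.length) : W.getD i false = y.getD i false := by
    rw [← hu, List.getD_append _ _ _ _ hi]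
  have map_tail_eq : (List.range (y.length - 1)).map (fun i => W.getD (i + 1) false) = y.tail :=
    List.ext_getElem (by simp) fun i hi _ => by
      rw [List.length_map, List.length_range] at hi
      have hi' : i + 1 < y.length := by omega
      rw [List.getElem_map, List.getElem_range, getD_eq _ hi', List.getElem_tail,
        List.getD_eq_getElem _ _ hi']
  rw [List.map_cons, List.map_map, h.val_finalWire hy getD_eq computes]
  simp only [comp_def, map_tail_eq]
  obtain ⟨b, y', rfl⟩ := List.exists_cons_of_length_pos hy
  cases acc _ <;> simp

end Simulates

end Simulator

theorem mem_FPNCCircExact_of_circuit {R : Set (List Bool × List Bool)} {C : List Bool → Circuit}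
    (hC : Poly fun x => (C x).encode) (huniq : ∀ x, ∃! y, (x, y) ∈ R)
    (hR : ∀ x w, (x, w) ∈ R ↔ (C x).outputs.map (((C x).wires w).getD · false) = w) :
    R ∈ FPNCCircExact := by
  have mem_iff (x w) : (x, w) ∈ R ↔
      ∃ v : List.Vector Bool (C x).width, IsFixedPt (C x).fn v ∧ v.toList = w :=
    (hR x w).trans ((C x).exists_isFixedPt_iff w).symm
  refine ⟨⟨C, hC.congr fun _ => rfl, fun x => ?_⟩, mem_iff⟩
  obtain ⟨y, hy, eq_y⟩ := huniq x
  obtain ⟨v, hv, rfl⟩ := (mem_iff x y).1 hy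
  exact ⟨v, hv, fun v' hv' =>
    List.Vector.toList_injective (eq_y _ ((mem_iff x _).2 ⟨v', hv', rfl⟩))⟩

theorem mem_FPNCCircExact_of_mem_TFUP {R : Set (List Bool × List Bool)} (hR : R ∈ TFUP)
    (hl : PolyTimeSolutionLength R) : R ∈ FPNCCircExact := by
  classical
  obtain ⟨hdec, -, huniq⟩ := hR
  obtain ⟨l, hl, length_eq⟩ := hl
  rw [polyTime_encodeUnary_iff] at hl
  obtain ⟨X, _, rule, init, acc, p, hp⟩ := PolyTime.exists_automaton hdec
  obtain ⟨τ, enc, hτ⟩ := Simulator.exists_simulates (rule := rule) (init := init) (acc := acc)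
  let C (x : List Bool) := τ.circuit x (l x) (p.eval (x.length + 1 + l x))
  refine mem_FPNCCircExact_of_circuit (C := C)
    (Simulator.poly_encode_circuit Poly.id hl (.eval p (by fun_prop))) huniq fun x w => ?_
  by_cases hw : w.length = l x
  · rcases w.length.eq_zero_or_pos with h₀ | h₀
    · obtain rfl := List.length_eq_zero_iff.1 h₀
      obtain ⟨y, hy, -⟩ := huniq x
      obtain rfl : y = [] := List.length_eq_zero_iff.1 ((length_eq x y hy).trans hw.symm)
      simp [hy, C, ← hw, Simulator.circuit]
    · have accepts_iff := hp (x, w) (p.eval (x.length + 1 + w.length))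
        (le_of_eq (by simp [encodePair, add_assoc, add_comm 1]))
      simp only [C, ← hw]
      rw [hτ.outputs_eq_iff h₀, Simulator.pairRun, accepts_iff, decide_eq_true_iff]
  · refine iff_of_false (fun h => hw (length_eq x w h)) fun h => hw ?_
    rw [← congrArg List.length h, List.length_map, (C x).outputs_length]
    exact Simulator.width_circuit _ _ _

/-! ### Padding -/

section Padding

/-- The string `y` padded to length `n`, which has to be larger than the length of `y`. -/
def pad (n : ℕ) (y : List Bool) : List Bool := y ++ true :: List.replicate (n - y.length - 1) false

theorem length_pad {n : ℕ} {y : List Bool} (h : y.length < n) : (pad n y).length = n := by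
  simp only [pad, List.length_append, List.length_cons, List.length_replicate]
  omega

theorem true_mem_pad (n : ℕ) (y : List Bool) : true ∈ pad n y := by simp [pad]

theorem unpad_append_replicate (w : List Bool) (n : ℕ) :
    unpad (w ++ List.replicate n false) = unpad w := by
  simp [unpad, List.rdropWhile]

theorem unpad_replicate (n : ℕ) : unpad (List.replicate n false) = [] :=
  unpad_append_replicate [] n

theorem unpad_pad (n : ℕ) (y : List Bool) : unpad (pad n y) = y := by
  rw [pad, List.append_cons, unpad_append_replicate]
  simp [unpad]

theorem exists_eq_unpad_append {w : List Bool} (h : true ∈ w) :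
    ∃ k, w = unpad w ++ true :: List.replicate k false := by
  induction w using List.reverseRecOn with
  | nil => cases h
  | append_singleton w b ih =>
    cases b with
    | true => exact ⟨0, by simp [unpad]⟩
    | false =>
      obtain ⟨k, hk⟩ := ih (by simpa using h)
      refine ⟨k + 1, ?_⟩
      rw [show unpad (w ++ [false]) = unpad w from unpad_append_replicate w 1,
        List.replicate_succ', ← List.cons_append, ← List.append_assoc, ← hk]

theorem length_unpad_lt {w : List Bool} (h : true ∈ w) : (unpad w).length < w.length := by
  obtain ⟨k, hk⟩ := exists_eq_unpad_append h
  have := congrArg List.length hk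
  simp only [List.length_append, List.length_cons] at this
  omega

theorem pad_unpad {w : List Bool} (h : true ∈ w) : pad w.length (unpad w) = w := by
  obtain ⟨k, hk⟩ := exists_eq_unpad_append h
  have length_eq := congrArg List.length hk
  simp only [List.length_append, List.length_cons, List.length_replicate] at length_eq
  rw [pad, show w.length - (unpad w).length - 1 = k by omega, ← hk]

theorem eq_replicate_false_of_true_notMem {w : List Bool} (h : true ∉ w) :
    w = List.replicate w.length false :=
  List.eq_replicate_iff.2 ⟨rfl, fun b hb => by cases b; exacts [rfl, absurd hb h]⟩

theorem length_unpad_le (w : List Bool) : (unpad w).length ≤ w.length := by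
  by_cases h : true ∈ w
  · exact (length_unpad_lt h).le
  · rw [eq_replicate_false_of_true_notMem h, unpad_replicate]
    exact Nat.zero_le _

theorem exists_unpad_eq_iff {S : Set (List Bool)} {n : ℕ} (hS : ∀ w ∈ S, w.length = n)
    {y : List Bool} : (∃ w ∈ S, unpad w = y) ↔
      y.length < n ∧ pad n y ∈ S ∨ y = [] ∧ List.replicate n false ∈ S := by
  constructor
  · rintro ⟨w, hw, rfl⟩
    obtain rfl := hS w hw
    by_cases h : true ∈ w
    · exact .inl ⟨length_unpad_lt h, by rwa [pad_unpad h]⟩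
    · have w_eq := eq_replicate_false_of_true_notMem h
      exact .inr ⟨by rw [w_eq, unpad_replicate], w_eq ▸ hw⟩
  · rintro (⟨-, h⟩ | ⟨rfl, h⟩)
    · exact ⟨_, h, unpad_pad n y⟩
    · exact ⟨_, h, unpad_replicate n⟩

variable {ε : Type} [Coded ε]

@[fun_prop]
theorem poly_pad {n : ε → ℕ} {y : ε → List Bool} (hn : Poly n) (hy : Poly y) :
    Poly (fun e => pad (n e) (y e)) := by
  unfold pad
  fun_prop

@[fun_prop]
theorem poly_unpad {w : ε → List Bool} (hw : Poly w) : Poly (fun e => unpad (w e)) := by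
  have : Poly (fun e => ((w e).reverse.dropWhile (fun b => !b)).tail.reverse) := by fun_prop
  simpa only [unpad, List.rdropWhile, List.dropLast_reverse] using this

theorem poly_decide_true_mem {w : ε → List Bool} (hw : Poly w) :
    Poly (fun e => decide (true ∈ w e)) := by
  have : Poly (fun e => !((w e).dropWhile (fun b => !b)).isEmpty) := by fun_prop
  refine this.congr fun e => congrArg _ ?_
  rw [Bool.eq_iff_iff]
  simp [List.dropWhile_eq_nil_iff]

end Padding

/-- The relation with the padding of the solutions removed. -/
def unpadSolutions (R : Set (List Bool × List Bool)) : Set (List Bool × List Bool) :=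
  {p | ∃ w, (p.1, w) ∈ R ∧ unpad w = p.2}

/-- The relation with the solutions for `x` padded to length `l x`. -/
def padSolutions (l : List Bool → ℕ) (R : Set (List Bool × List Bool)) :
    Set (List Bool × List Bool) :=
  {p | p.2.length = l p.1 ∧ true ∈ p.2 ∧ (p.1, unpad p.2) ∈ R}

section Classes

variable {R : Set (List Bool × List Bool)}

theorem mem_FPNCCirc_iff : R ∈ FPNCCirc ↔ ∃ R' ∈ FPNCCircExact, unpadSolutions R' = R := by
  have decides_iff (𝒜 : Algorithm) {R' : Set (List Bool × List Bool)}
      (h : 𝒜.DecidesExactly R') : 𝒜.Decides R ↔ unpadSolutions R' = R := by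
    have mem_unpadSolutions_iff (x y : List Bool) : (x, y) ∈ unpadSolutions R' ↔
        ∃ w : List.Vector Bool (𝒜.circuit x).width,
          IsFixedPt (𝒜.circuit x).fn w ∧ unpad w.toList = y := by
      simp only [unpadSolutions, Set.mem_ofPred_eq, h x]
      aesop
    simp only [Algorithm.Decides, Set.ext_iff, Prod.forall, mem_unpadSolutions_iff, iff_comm]
  constructor
  · rintro ⟨𝒜, h⟩
    have decidesExactly : 𝒜.DecidesExactly {p | ∃ w : List.Vector Bool (𝒜.circuit p.1).width,
      IsFixedPt (𝒜.circuit p.1).fn w ∧ w.toList = p.2} := fun _ _ => Iff.rfl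
    exact ⟨_, ⟨𝒜, decidesExactly⟩, (decides_iff 𝒜 decidesExactly).1 h⟩
  · rintro ⟨R', ⟨𝒜, h⟩, hR⟩
    exact ⟨𝒜, (decides_iff 𝒜 h).2 hR⟩

open Classical in
theorem Algorithm.DecidesExactly.polynomiallyDecidable {𝒜 : Algorithm}
    (h : 𝒜.DecidesExactly R) : PolynomiallyDecidable R := by
  have hc := 𝒜.poly_encode
  have poly_check : Poly (fun p : List Bool × List Bool =>
      checkFixed (𝒜.circuit p.1).encode p.2) :=
    poly_checkFixed.comp ((hc.comp Poly.fst).prodMk Poly.snd)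
  refine polynomiallyDecidable_iff.2 (poly_check.congr fun p => congrArg _ ?_)
  rw [Bool.eq_iff_iff, checkFixed_encode, decide_eq_true_iff, decide_eq_true_iff,
    ← Circuit.exists_isFixedPt_iff]
  exact h p.1 p.2

theorem Algorithm.DecidesExactly.length_eq {𝒜 : Algorithm} (h : 𝒜.DecidesExactly R)
    {x y : List Bool} (hxy : (x, y) ∈ R) : y.length = (𝒜.circuit x).width := by
  obtain ⟨v, -, rfl⟩ := (h x y).1 hxy
  exact v.toList_length

theorem Algorithm.DecidesExactly.existsUnique {𝒜 : Algorithm} (h : 𝒜.DecidesExactly R)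
    (x : List Bool) : ∃! y, (x, y) ∈ R := by
  obtain ⟨v, hv, eq_v⟩ := 𝒜.consistent x
  refine ⟨v.toList, (h _ _).2 ⟨v, hv, rfl⟩, fun y hy => ?_⟩
  obtain ⟨v', hv', rfl⟩ := (h _ _).1 hy
  rw [eq_v v' hv']

theorem mem_FPNCCircExact_iff : R ∈ FPNCCircExact ↔ R ∈ TFUP ∧ PolyTimeSolutionLength R := by
  refine ⟨?_, fun h => mem_FPNCCircExact_of_mem_TFUP h.1 h.2⟩
  rintro ⟨𝒜, h⟩
  obtain ⟨q, hq⟩ := 𝒜.poly_width.exists_size_le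
  simp only [size_nat, size_list] at hq
  exact ⟨⟨h.polynomiallyDecidable, ⟨q, fun x y hxy => (h.length_eq hxy).trans_le (hq x)⟩,
    h.existsUnique⟩, _, polyTime_encodeUnary_iff.2 𝒜.poly_width, fun _ _ => h.length_eq⟩

open Classical in
theorem polynomiallyDecidable_unpadSolutions (hR : PolynomiallyDecidable R)
    (hl : PolyTimeSolutionLength R) : PolynomiallyDecidable (unpadSolutions R) := by
  obtain ⟨l, hl, length_eq⟩ := hl
  rw [polyTime_encodeUnary_iff] at hl
  rw [polynomiallyDecidable_iff] at hR ⊢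
  have poly_lt : Poly (fun p : List Bool × List Bool => decide (p.2.length < l p.1)) :=
    .decide_lt (by fun_prop) (by fun_prop)
  have poly_mem_pad : Poly (fun p : List Bool × List Bool =>
      decide ((p.1, pad (l p.1) p.2) ∈ R)) :=
    hR.comp (f := fun p : List Bool × List Bool => (p.1, pad (l p.1) p.2)) (by fun_prop)
  have poly_mem_zeros : Poly (fun p : List Bool × List Bool =>
      decide ((p.1, List.replicate (l p.1) false) ∈ R)) :=
    hR.comp (f := fun p : List Bool × List Bool => (p.1, List.replicate (l p.1) false))
      (by fun_prop)
  refine ((poly_lt.and poly_mem_pad).or (Poly.snd.isEmpty.and poly_mem_zeros)).congr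
    fun ⟨x, y⟩ => congrArg _ ?_
  rw [Bool.eq_iff_iff]
  simp only [decide_eq_true_iff, Bool.or_eq_true, Bool.and_eq_true, List.isEmpty_iff]
  exact exists_unpad_eq_iff (S := {w | (x, w) ∈ R}) (length_eq x)

theorem unpadSolutions_mem_TFUP (hR : R ∈ TFUP) (hl : PolyTimeSolutionLength R) :
    unpadSolutions R ∈ TFUP := by
  obtain ⟨hdec, ⟨q, hq⟩, huniq⟩ := hR
  refine ⟨polynomiallyDecidable_unpadSolutions hdec hl, ⟨q, ?_⟩, fun x => ?_⟩
  · rintro x _ ⟨w, hw, rfl⟩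
    exact (length_unpad_le w).trans (hq x w hw)
  · obtain ⟨w, hw, eq_w⟩ := huniq x
    refine ⟨unpad w, ⟨w, hw, rfl⟩, ?_⟩
    rintro _ ⟨w', hw', rfl⟩
    rw [eq_w w' hw']

variable {l : List Bool → ℕ}

theorem pad_mem_padSolutions {x y : List Bool} (hxy : (x, y) ∈ R) (hl : y.length < l x) :
    (x, pad (l x) y) ∈ padSolutions l R :=
  ⟨length_pad hl, true_mem_pad _ _, by rwa [unpad_pad]⟩

theorem unpadSolutions_padSolutions (hl : ∀ x y, (x, y) ∈ R → y.length < l x) :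
    unpadSolutions (padSolutions l R) = R := by
  ext ⟨x, y⟩
  constructor
  · rintro ⟨w, hw, rfl⟩
    exact hw.2.2
  · exact fun hxy => ⟨_, pad_mem_padSolutions hxy (hl x y hxy), unpad_pad _ _⟩

open Classical in
theorem polynomiallyDecidable_padSolutions (hR : PolynomiallyDecidable R) (hl : Poly l) :
    PolynomiallyDecidable (padSolutions l R) := by
  rw [polynomiallyDecidable_iff] at hR ⊢
  have poly_length_eq : Poly (fun p : List Bool × List Bool => decide (p.2.length = l p.1)) :=
    .decide_eq (by fun_prop) (by fun_prop)
  have poly_mem_unpad : Poly (fun p : List Bool × List Bool => decide ((p.1, unpad p.2) ∈ R)) :=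
    hR.comp (f := fun p : List Bool × List Bool => (p.1, unpad p.2)) (by fun_prop)
  refine (poly_length_eq.and ((poly_decide_true_mem Poly.snd).and poly_mem_unpad)).congr
    fun p => congrArg _ ?_
  rw [Bool.eq_iff_iff]
  simp only [Bool.and_eq_true, decide_eq_true_iff]
  rfl

theorem padSolutions_mem_TFUP (hR : R ∈ TFUP) (hl : Poly l)
    (hlt : ∀ x y, (x, y) ∈ R → y.length < l x) : padSolutions l R ∈ TFUP := by
  obtain ⟨q, hq⟩ := hl.exists_size_le
  simp only [size_nat, size_list] at hq
  refine ⟨polynomiallyDecidable_padSolutions hR.1 hl,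
    ⟨q, fun x w hw => hw.1.trans_le (hq x)⟩, fun x => ?_⟩
  obtain ⟨y, hy, eq_y⟩ := hR.2.2 x
  refine ⟨_, pad_mem_padSolutions hy (hlt x y hy), fun w ⟨length_eq, true_mem, hw⟩ => ?_⟩
  rw [← eq_y _ hw, ← length_eq, pad_unpad true_mem]

theorem FPNCCirc_eq_TFUP : FPNCCirc = TFUP := by
  ext R
  simp only [mem_FPNCCirc_iff, mem_FPNCCircExact_iff]
  constructor
  · rintro ⟨R', ⟨hR', hl⟩, rfl⟩
    exact unpadSolutions_mem_TFUP hR' hl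
  · intro hR
    obtain ⟨q, hq⟩ := hR.2.1
    have poly_bound : Poly (fun x : List Bool => q.eval x.length + 1) :=
      (Poly.eval q (by fun_prop)).add (.const 1)
    have length_lt (x y) (hxy : (x, y) ∈ R) : y.length < q.eval x.length + 1 :=
      Nat.lt_succ_of_le (hq x y hxy)
    exact ⟨_, ⟨padSolutions_mem_TFUP hR poly_bound length_lt,
      _, polyTime_encodeUnary_iff.2 poly_bound, fun _ _ h => h.1⟩,
      unpadSolutions_padSolutions length_lt⟩

end Classes

end NCCirc

theorem theorem3 :
    NCCirc.FPNCCirc = NCCirc.TFUP ∧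
    NCCirc.FPNCCircExact = {R | R ∈ NCCirc.TFUP ∧ NCCirc.PolyTimeSolutionLength R} :=
  ⟨NCCirc.FPNCCirc_eq_TFUP, Set.ext fun _ => NCCirc.mem_FPNCCircExact_iff⟩
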